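/- For a real number $y$, call an integer $n$ \emph{$y$-smooth} if no prime $p>y$ divides $n$ (so $n$ is $y$-smooth if and only if $-n$ is, and $0$ is not $y$-smooth). For real $x,y>0$ let $\Psi(x,y)$ denote the number of $y$-smooth positive integers $n\le x$, and let $$\rho(u)=\lim_{x\to\infty}\frac{\Psi(x,x^{1/u})}{x}\qquad(u\ge 1)$$ be Dickman's function. \textbf{Theorem.} Let $0<\theta\le 1$ and $\gamma>0$. The limit defining $\rho(1/\theta)$ exists, and there is $\nu=\nu(\theta,\gamma)\in(0,1)$ such that, for all sufficiently large real $x$ (depending only on $\theta,\gamma,\nu$), all sets $A,B\subseteq\{1,2,\dots,\lfloor x\rfloor\}$ with $|A|>x^{\nu}$ and $|B|>x^{\nu}$ satisfy $$\Bigl|\,\#\{(a,b)\in A\times B:\ a+b\text{ is }x^{\theta}\text{-smooth}\}-\rho(1/\theta)\,|A|\,|B|\,\Bigr|<\gamma\,|A|\,|B|.$$ The same holds for differences: there is $\nu'=\nu'(\theta,\gamma)\in(0,1)$, possibly different from $\nu$, such that, for all sufficiently large real $x$ (depending only on $\theta,\gamma,\nu'$), all sets $A,B\subseteq\{1,2,\dots,\lfloor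 x\rfloor\}$ with $|A|>x^{\nu'}$ and $|B|>x^{\nu'}$ satisfy $$\Bigl|\,\#\{(a,b)\in A\times B:\ a-b\text{ is }x^{\theta}\text{-smooth}\}-\rho(1/\theta)\,|A|\,|B|\,\Bigr|<\gamma\,|A|\,|B|.$$ -/

import Mathlib

open Filter Topology

/-- An integer `n` is `y`-smooth if it has no prime divisor greater than `y`. The sign of `n` plays
no role, and `0`, being divisible by every prime, is not `y`-smooth for any real `y`. -/
def IsSmooth (y : ℝ) (n : ℤ) : Prop :=
  ∀ p : ℕ, p.Prime → (p : ℤ) ∣ n → (p : ℝ) ≤ y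

noncomputable instance instDecidablePredIsSmooth (y : ℝ) : DecidablePred (IsSmooth y) :=
  fun _ => Classical.propDecidable _

/-- `smoothCount x y` is `Ψ(x, y)`, the number of `y`-smooth positive integers `n ≤ x`. -/
noncomputable def smoothCount (x y : ℝ) : ℕ :=
  ((Finset.Icc 1 ⌊x⌋₊).filter (fun n : ℕ => IsSmooth y (n : ℤ))).card

/-- Dickman's function `ρ(u) = lim_{x → ∞} Ψ(x, x^{1/u}) / x`. -/
noncomputable def dickmanRho (u : ℝ) : ℝ :=
  limUnder atTop (fun x : ℝ => (smoothCount x (x ^ (1 / u)) : ℝ) / x)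

/-! Put `u = x ^ θ` and `Q = x ^ (1 - η / 2)` with `η` small. A nonzero `n` is `u`-smooth exactly
when the Möbius sum over its squarefree divisors composed of primes above `u` equals 1. Truncating
this sum to divisors `d ≤ Q` loses nothing as soon as `n`, of size at most `2 * x`, has a prime
factor `p` in `(x ^ η, x ^ (θ / 4)]`: the product of its primes above `u` is then at most `2 * x / p
≤ Q`. A second moment argument (`card_no_prime_le`) shows that few `n` lack such a `p`, and for
those the truncated sum is bounded by `2 ^ K` with `K` depending on `θ` only. Hence any family that
is equidistributed on average modulo `x ^ η`-rough `d ≤ Q` contains about `T * sieveMainTerm θ η x`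
smooth values (`smooth_count_of_equidistributed`).

For the sums `a + b` the equidistribution comes from the large sieve. The fractions `h / d` with `d`
rough have reduced denominators above `x ^ η`, so up to logarithms the total error is `(x / x ^ η +
Q) * √(|A| |B|)`, which is negligible once both sets exceed `x ^ (1 - η / 4)`.

The main term is never evaluated. The integers up to `x` are another equidistributed family, so it
must be close to `Ψ(x, x ^ θ) / x`. That this ratio converges follows from Buchstab's identity and
Mertens' theorem, by induction on the exponent. Differences are sums with `-B`. -/

/-! ### Mertens' theorems. -/

/-- The primes in the interval `(a, b]`. -/
noncomputable def primesIoc (a b : ℝ) : Finset ℕ := (Finset.Ioc ⌊a⌋₊ ⌊b⌋₊).filter Nat.Prime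

theorem mem_primesIoc {a b : ℝ} (ha : 0 ≤ a) {p : ℕ} :
    p ∈ primesIoc a b ↔ p.Prime ∧ a < p ∧ (p : ℝ) ≤ b := by
  simp only [primesIoc, Finset.mem_filter, Finset.mem_Ioc, Nat.floor_lt ha]
  constructor
  · rintro ⟨⟨h1, h2⟩, h3⟩
    exact ⟨h3, h1, (Nat.le_floor_iff' h3.ne_zero).1 h2⟩
  · rintro ⟨h3, h1, h2⟩
    exact ⟨⟨h1, (Nat.le_floor_iff' h3.ne_zero).2 h2⟩, h3⟩

theorem sum_primesIoc_add {a b c : ℝ} (hab : a ≤ b) (hbc : b ≤ c) (f : ℕ → ℝ) :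
    ∑ p ∈ primesIoc a b, f p + ∑ p ∈ primesIoc b c, f p = ∑ p ∈ primesIoc a c, f p := by
  unfold primesIoc
  rw [← Finset.sum_union, ← Finset.filter_union,
    Finset.Ioc_union_Ioc_eq_Ioc (Nat.floor_le_floor hab) (Nat.floor_le_floor hbc)]
  rw [Finset.disjoint_left]
  intro p hp hq
  simp only [Finset.mem_filter, Finset.mem_Ioc] at hp hq
  omega

theorem log_factorial_eq_sum_primes (N : ℕ) :
    Real.log (N.factorial : ℝ) =
      ∑ p ∈ primesIoc 0 N, (N.factorial.factorization p : ℝ) * Real.log p := by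
  rw [Real.log_nat_eq_sum_factorization, Finsupp.sum]
  apply Finset.sum_subset
  · intro p hp
    rw [Nat.support_factorization, Nat.mem_primeFactors] at hp
    rw [mem_primesIoc le_rfl]
    exact ⟨hp.1, by exact_mod_cast hp.1.pos, by exact_mod_cast (hp.1.dvd_factorial).1 hp.2.1⟩
  · intro p _ hp
    rw [Finsupp.notMem_support_iff] at hp
    simp [hp]

theorem factorization_factorial_lower {p N : ℕ} (hp : p.Prime) :
    (N : ℝ) / p - 1 ≤ N.factorial.factorization p := by
  have h : N / p ≤ N.factorial.factorization p := by
    rw [← hp.pow_dvd_iff_le_factorization (Nat.factorial_ne_zero _)]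
    have h1 : p ^ (N / p) ∣ (p * (N / p)).factorial := by
      have h2 : ∀ m : ℕ, p ^ m ∣ (p * m).factorial := by
        intro m
        induction m with
        | zero => simp
        | succ m ih =>
          have h3 : (p * (m + 1)) * (p * (m + 1) - 1).factorial = (p * (m + 1)).factorial :=
            Nat.mul_factorial_pred (by have := hp.pos; positivity)
          rw [← h3, pow_succ, mul_comm]
          refine mul_dvd_mul (dvd_mul_right _ _) (ih.trans (Nat.factorial_dvd_factorial ?_))
          have := hp.pos
          rw [mul_add]; omega
      exact h2 _
    exact h1.trans (Nat.factorial_dvd_factorial (Nat.mul_div_le _ _))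
  have h2 : (N : ℝ) / p - 1 ≤ (N / p : ℕ) := by
    have := (Nat.lt_floor_add_one ((N : ℝ) / p)).le
    rw [Nat.floor_div_eq_div] at this
    linarith
  exact h2.trans (by exact_mod_cast h)

/-- Legendre: `(p - 1) * v_p(N!)` equals `N` minus the digit sum of `N` in base `p`. -/
theorem factorization_factorial_upper {p N : ℕ} (hp : p.Prime) :
    (N.factorial.factorization p : ℝ) ≤ (N : ℝ) / (p - 1) := by
  have := Fact.mk hp
  have h := sub_one_mul_padicValNat_factorial (p := p) N
  rw [Nat.factorization_def _ hp]
  have h1 : (1 : ℝ) < p := by exact_mod_cast hp.one_lt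
  rw [le_div_iff₀ (by linarith)]
  have h2 : (p - 1) * padicValNat p N.factorial ≤ N := h.le.trans (Nat.sub_le _ _)
  have h3 : (((p - 1 : ℕ) : ℝ)) = p - 1 := by
    rw [Nat.cast_sub hp.one_lt.le]; simp
  rw [mul_comm, ← h3]
  exact_mod_cast h2

/-- This is the cost of replacing `1 / (p - 1)` by `1 / p` in Legendre's bound. Since `log p ≤ 2 *
√p` and `p ≤ 2 * (p - 1)`, each term is at most `4 / p ^ (3 / 2)`. -/
theorem sum_log_div_mul_pred_bounded :
    ∃ C : ℝ, 0 ≤ C ∧ ∀ s : Finset ℕ, (∀ p ∈ s, p.Prime) →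
      ∑ p ∈ s, Real.log p / (p * (p - 1)) ≤ C := by
  have hs : Summable (fun n : ℕ => 4 * (1 / (n : ℝ) ^ (3 / 2 : ℝ))) :=
    (Real.summable_one_div_nat_rpow.2 (by norm_num)).mul_left 4
  refine ⟨∑' n : ℕ, 4 * (1 / (n : ℝ) ^ (3 / 2 : ℝ)), tsum_nonneg fun n => by positivity,
    fun s hsp => ?_⟩
  refine le_trans (Finset.sum_le_sum fun p hp => ?_)
    (hs.sum_le_tsum s fun n _ => by positivity)
  have h2 : (2 : ℝ) ≤ p := by exact_mod_cast (hsp p hp).two_le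
  have hl : Real.log p ≤ (p : ℝ) ^ (1 / 2 : ℝ) / (1 / 2) :=
    Real.log_le_rpow_div (by linarith) (by norm_num)
  have hp0 : (0 : ℝ) < p := by linarith
  have h3 : (p : ℝ) ^ (3 / 2 : ℝ) * (p : ℝ) ^ (1 / 2 : ℝ) = p * p := by
    rw [← Real.rpow_add hp0]; norm_num; ring
  have h4 : 0 < (p : ℝ) ^ (3 / 2 : ℝ) := by positivity
  have h5 : 0 < (p : ℝ) ^ (1 / 2 : ℝ) := by positivity
  rw [div_le_iff₀ (by nlinarith), mul_one_div, div_mul_eq_mul_div, le_div_iff₀ h4]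
  calc Real.log p * (p : ℝ) ^ (3 / 2 : ℝ)
      ≤ (p : ℝ) ^ (1 / 2 : ℝ) / (1 / 2) * (p : ℝ) ^ (3 / 2 : ℝ) := by gcongr
    _ = 2 * (p * p) := by rw [← h3]; ring
    _ ≤ 4 * (p * (p - 1)) := by nlinarith

theorem log_factorial_lower (N : ℕ) : N * Real.log N - N ≤ Real.log (N.factorial : ℝ) := by
  rcases Nat.eq_zero_or_pos N with rfl | hN
  · simp
  have hN' : (0 : ℝ) < N := by exact_mod_cast hN
  have h := Real.pow_div_factorial_le_exp (N : ℝ) hN'.le N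
  have hf : (0 : ℝ) < N.factorial := by exact_mod_cast N.factorial_pos
  have h2 := Real.log_le_log (by positivity) h
  rw [Real.log_exp, Real.log_div (by positivity) hf.ne', Real.log_pow] at h2
  linarith

theorem log_factorial_upper (N : ℕ) : Real.log (N.factorial : ℝ) ≤ N * Real.log N := by
  rw [← Real.log_pow]
  apply Real.log_le_log (by exact_mod_cast N.factorial_pos)
  exact_mod_cast N.factorial_le_pow

/-- Two estimates of `log N!` are compared, one by size and one by prime factorization. In the upper
bound, the loss of 1 for each prime adds up to Chebyshev's `θ(N)`, which is `O(N)`. -/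
theorem mertens_nat : ∃ C : ℝ, 0 ≤ C ∧ ∀ N : ℕ, 1 ≤ N →
    |∑ p ∈ primesIoc 0 N, Real.log p / p - Real.log N| ≤ C := by
  obtain ⟨C, hC0, hC⟩ := sum_log_div_mul_pred_bounded
  refine ⟨C + 1 + Real.log 4, by have := Real.log_nonneg (x := 4) (by norm_num); linarith,
    fun N hN => ?_⟩
  have hN' : (0 : ℝ) < N := by exact_mod_cast hN
  have hpr : ∀ p ∈ primesIoc 0 N, p.Prime := fun p hp => ((mem_primesIoc le_rfl).1 hp).1
  have hl4 := Real.log_nonneg (x := 4) (by norm_num)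
  rw [abs_le]
  constructor
  · have h1 : Real.log (N.factorial : ℝ) ≤
        N * (∑ p ∈ primesIoc 0 N, Real.log p / p +
          ∑ p ∈ primesIoc 0 N, Real.log p / (p * (p - 1))) := by
      rw [log_factorial_eq_sum_primes, ← Finset.sum_add_distrib, Finset.mul_sum]
      refine Finset.sum_le_sum fun p hp => ?_
      have h2 : (2 : ℝ) ≤ p := by exact_mod_cast (hpr p hp).two_le
      have h3 : (p : ℝ) - 1 ≠ 0 := by linarith
      refine (mul_le_mul_of_nonneg_right (factorization_factorial_upper (hpr p hp))
        (Real.log_nonneg (by linarith))).trans (le_of_eq ?_)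
      field_simp
      ring
    have h2 := log_factorial_lower N
    have h3 := hC _ hpr
    have h4 : N * (Real.log N - 1) ≤ N * (∑ p ∈ primesIoc 0 N, Real.log p / p + C) := by
      refine le_trans (by linarith) (h1.trans ?_)
      gcongr
    have := le_of_mul_le_mul_left h4 hN'
    linarith
  · have h1 : N * (∑ p ∈ primesIoc 0 N, Real.log p / p) - Chebyshev.theta N ≤
        Real.log (N.factorial : ℝ) := by
      rw [log_factorial_eq_sum_primes, Chebyshev.theta, Finset.mul_sum]
      have : (Finset.Ioc 0 ⌊(N : ℝ)⌋₊).filter Nat.Prime = primesIoc 0 N := by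
        simp [primesIoc]
      rw [this, ← Finset.sum_sub_distrib]
      refine Finset.sum_le_sum fun p hp => ?_
      have h2 : (2 : ℝ) ≤ p := by exact_mod_cast (hpr p hp).two_le
      refine le_trans (le_of_eq ?_)
        (mul_le_mul_of_nonneg_right (factorization_factorial_lower (hpr p hp))
        (Real.log_nonneg (by linarith)))
      field_simp
    have h2 := log_factorial_upper N
    have h3 := Chebyshev.theta_le_log4_mul_x hN'.le
    have h4 : N * (∑ p ∈ primesIoc 0 N, Real.log p / p) ≤ N * (Real.log N + Real.log 4) := by
      linarith
    have := le_of_mul_le_mul_left h4 hN'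
    linarith

/-- Mertens' first theorem. -/
theorem mertens_first : ∃ C : ℝ, 0 ≤ C ∧ ∀ x : ℝ, 1 ≤ x →
    |∑ p ∈ primesIoc 0 x, Real.log p / p - Real.log x| ≤ C := by
  obtain ⟨C, hC0, hC⟩ := mertens_nat
  refine ⟨C + Real.log 2, by have := Real.log_nonneg (x := 2) (by norm_num); linarith,
    fun x hx => ?_⟩
  have hN : 1 ≤ ⌊x⌋₊ := Nat.one_le_floor_iff _ |>.2 hx
  have hN' : (1 : ℝ) ≤ ⌊x⌋₊ := by exact_mod_cast hN
  have h1 := hC _ hN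
  have h2 : primesIoc 0 (⌊x⌋₊ : ℝ) = primesIoc 0 x := by simp [primesIoc]
  rw [h2] at h1
  have h3 : Real.log ⌊x⌋₊ ≤ Real.log x :=
    Real.log_le_log (by linarith) (Nat.floor_le (by linarith))
  have h4 : Real.log x ≤ Real.log 2 + Real.log ⌊x⌋₊ := by
    rw [← Real.log_mul (by norm_num) (by linarith)]
    apply Real.log_le_log (by linarith)
    have := Nat.lt_floor_add_one x
    linarith
  rw [abs_le] at h1 ⊢
  have := Real.log_nonneg (x := 2) (by norm_num)
  constructor <;> linarith

theorem sum_primesIoc_log_div : ∃ C : ℝ, 0 ≤ C ∧ ∀ a b : ℝ, 1 ≤ a → a ≤ b →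
    |∑ p ∈ primesIoc a b, Real.log p / p - (Real.log b - Real.log a)| ≤ C := by
  obtain ⟨C, hC0, hC⟩ := mertens_first
  refine ⟨2 * C, by linarith, fun a b ha hab => ?_⟩
  have h1 := hC a ha
  have h2 := hC b (ha.trans hab)
  rw [← sum_primesIoc_add (by linarith) hab] at h2
  rw [abs_le] at *
  constructor <;> linarith

/-- On this range `log p` lies between `s * log x` and `t * log x`, so the sum of `log p / p`
controls that of `1 / p`. The error is of second order in `t / s - 1`, so cutting a long range into
many short ones makes it disappear; this replaces partial summation. -/
theorem sum_primesIoc_inv_near {s t ε : ℝ} (hs : 0 < s) (hst : s ≤ t) (hε : 0 < ε) :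
    ∀ᶠ x : ℝ in atTop,
      |∑ p ∈ primesIoc (x ^ s) (x ^ t), (1 : ℝ) / p - Real.log (t / s)| ≤
        (t / s - 1) ^ 2 + ε := by
  obtain ⟨C, hC0, hC⟩ := sum_primesIoc_log_div
  have hlog : ∀ᶠ x : ℝ in atTop, C / (s * ε) + 1 ≤ Real.log x :=
    Real.tendsto_log_atTop.eventually_ge_atTop _
  filter_upwards [hlog, eventually_gt_atTop 1] with x hx hx1
  have hx0 : 0 < x := by linarith
  have hl : 0 < Real.log x := Real.log_pos hx1
  have ht : 0 < t := by linarith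
  have hCε : C / (s * Real.log x) ≤ ε := by
    rw [div_le_iff₀ (by positivity)]
    have : C / (s * ε) ≤ Real.log x := by linarith
    rw [div_le_iff₀ (by positivity)] at this
    linarith
  have hCε' : C / (t * Real.log x) ≤ ε := by
    refine le_trans ?_ hCε
    gcongr
  have h := hC (x ^ s) (x ^ t) (Real.one_le_rpow hx1.le hs.le)
    (Real.rpow_le_rpow_of_exponent_le hx1.le hst)
  rw [Real.log_rpow hx0, Real.log_rpow hx0, abs_le] at h
  have hmem : ∀ p ∈ primesIoc (x ^ s) (x ^ t), 0 < (p : ℝ) ∧ s * Real.log x ≤ Real.log p ∧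
      Real.log p ≤ t * Real.log x := by
    intro p hp
    rw [mem_primesIoc (by positivity)] at hp
    have hp0 : 0 < (p : ℝ) := by exact_mod_cast hp.1.pos
    refine ⟨hp0, ?_, ?_⟩
    · rw [← Real.log_rpow hx0]; exact Real.log_le_log (by positivity) hp.2.1.le
    · rw [← Real.log_rpow hx0]; exact Real.log_le_log hp0 hp.2.2
  have hup : ∑ p ∈ primesIoc (x ^ s) (x ^ t), (1 : ℝ) / p ≤
      (∑ p ∈ primesIoc (x ^ s) (x ^ t), Real.log p / p) / (s * Real.log x) := by
    rw [Finset.sum_div]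
    refine Finset.sum_le_sum fun p hp => ?_
    obtain ⟨h1, h2, h3⟩ := hmem p hp
    rw [le_div_iff₀ (by positivity), one_div_mul_eq_div]
    gcongr
  have hlo : (∑ p ∈ primesIoc (x ^ s) (x ^ t), Real.log p / p) / (t * Real.log x) ≤
      ∑ p ∈ primesIoc (x ^ s) (x ^ t), (1 : ℝ) / p := by
    rw [Finset.sum_div]
    refine Finset.sum_le_sum fun p hp => ?_
    obtain ⟨h1, h2, h3⟩ := hmem p hp
    rw [div_le_iff₀ (by positivity), one_div_mul_eq_div]
    gcongr
  have hup2 : (∑ p ∈ primesIoc (x ^ s) (x ^ t), Real.log p / p) / (s * Real.log x) ≤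
      (t / s - 1) + ε := by
    calc _ ≤ (C + (t * Real.log x - s * Real.log x)) / (s * Real.log x) := by
          gcongr; linarith
      _ = C / (s * Real.log x) + (t / s - 1) := by field_simp
      _ ≤ _ := by linarith
  have hlo2 : (1 - s / t) - ε ≤
      (∑ p ∈ primesIoc (x ^ s) (x ^ t), Real.log p / p) / (t * Real.log x) := by
    calc _ ≤ (1 - s / t) - C / (t * Real.log x) := by linarith
      _ = (-C + (t * Real.log x - s * Real.log x)) / (t * Real.log x) := by field_simp; ring
      _ ≤ _ := by gcongr; linarith
  have hr : 1 ≤ t / s := by rw [le_div_iff₀ hs]; linarith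
  have h1 : Real.log (t / s) ≤ t / s - 1 := Real.log_le_sub_one_of_pos (by positivity)
  have h2 : 1 - s / t ≤ Real.log (t / s) := by
    have := Real.one_sub_inv_le_log_of_pos (x := t / s) (by positivity)
    rwa [inv_div] at this
  have h3 : (t / s - 1) - (1 - s / t) ≤ (t / s - 1) ^ 2 := by
    have : s / t = 1 / (t / s) := by rw [one_div_div]
    rw [this]
    set r := t / s
    have : (r - 1) - (1 - 1 / r) = (r - 1) ^ 2 / r := by field_simp
    rw [this]
    exact div_le_self (sq_nonneg _) hr
  rw [abs_le]
  constructor <;> linarith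

/-- Mertens' second theorem in the form `∑_{x^s < p ≤ x^t} 1/p → log (t/s)`. -/
theorem tendsto_sum_primesIoc_inv {s t : ℝ} (hs : 0 < s) (hst : s ≤ t) :
    Tendsto (fun x : ℝ => ∑ p ∈ primesIoc (x ^ s) (x ^ t), (1 : ℝ) / p) atTop
      (𝓝 (Real.log (t / s))) := by
  rw [Metric.tendsto_nhds]
  intro ε hε
  set l := Real.log (t / s) with hl
  have ht : 0 < t := by linarith
  have hl0 : 0 ≤ l := Real.log_nonneg (by rw [le_div_iff₀ hs]; linarith)
  -- `N` geometric pieces of ratio `exp (l / N)` have total second-order error at most `N * (2 * l /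
  -- N) ^ 2 = 4 * l ^ 2 / N`. The condition `l < N` lets `exp t - 1` be bounded by `2 * t`.
  obtain ⟨N, hN⟩ := exists_nat_gt (max l (8 * l ^ 2 / ε))
  have hN0 : (0 : ℝ) < N := lt_of_le_of_lt (hl0.trans (le_max_left _ _)) hN
  have hN1 : l < N := (le_max_left _ _).trans_lt hN
  have hN2 : 4 * l ^ 2 / N < ε / 2 := by
    have := (le_max_right _ _).trans_lt hN
    rw [div_lt_iff₀ hε] at this
    rw [div_lt_iff₀ hN0]
    linarith
  set r := Real.exp (l / N) with hr
  have hr1 : 1 ≤ r := Real.one_le_exp (by positivity)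
  have hrsub : (r - 1) ^ 2 ≤ (2 * (l / N)) ^ 2 := by
    have h1 := Real.abs_exp_sub_one_le (x := l / N)
      (by rw [abs_of_nonneg (by positivity), div_le_one hN0]; exact hN1.le)
    rw [abs_of_nonneg (by positivity : 0 ≤ l / N)] at h1
    rw [← sq_abs]
    gcongr
  have hrN : s * r ^ N = t := by
    rw [hr, ← Real.exp_nat_mul, mul_div_cancel₀ _ hN0.ne', hl, Real.exp_log (by positivity)]
    field_simp
  have hev : ∀ᶠ x : ℝ in atTop, ∀ i ∈ Finset.range N,
      |∑ p ∈ primesIoc (x ^ (s * r ^ i)) (x ^ (s * r ^ (i + 1))), (1 : ℝ) / p - l / N| ≤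
        (2 * (l / N)) ^ 2 + ε / (2 * N) := by
    rw [eventually_all_finset]
    intro i _
    have hri : s * r ^ (i + 1) / (s * r ^ i) = r := by
      rw [pow_succ]; field_simp
    have := sum_primesIoc_inv_near (s := s * r ^ i) (t := s * r ^ (i + 1)) (ε := ε / (2 * N))
      (by positivity) (by gcongr; omega) (by positivity)
    filter_upwards [this] with x hx
    rw [hri, hr, Real.log_exp] at hx
    exact hx.trans (by gcongr)
  filter_upwards [hev, eventually_gt_atTop 1] with x hx hx1
  have hsum : ∀ n : ℕ, ∑ i ∈ Finset.range n,
      ∑ p ∈ primesIoc (x ^ (s * r ^ i)) (x ^ (s * r ^ (i + 1))), (1 : ℝ) / p =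
        ∑ p ∈ primesIoc (x ^ s) (x ^ (s * r ^ n)), (1 : ℝ) / p := by
    intro n
    induction n with
    | zero => simp [primesIoc]
    | succ n ih =>
      rw [Finset.sum_range_succ, ih]
      have h1 : 1 ≤ r ^ n := one_le_pow₀ hr1
      refine sum_primesIoc_add (Real.rpow_le_rpow_of_exponent_le hx1.le ?_)
        (Real.rpow_le_rpow_of_exponent_le hx1.le ?_) _
      · nlinarith
      · gcongr; omega
  rw [Real.dist_eq, ← hrN, ← hsum]
  have hls : l = ∑ i ∈ Finset.range N, l / N := by
    rw [Finset.sum_const, Finset.card_range, nsmul_eq_mul]; field_simp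
  rw [hls, ← Finset.sum_sub_distrib]
  calc _ ≤ ∑ i ∈ Finset.range N, ((2 * (l / N)) ^ 2 + ε / (2 * N)) :=
        (Finset.abs_sum_le_sum_abs _ _).trans (Finset.sum_le_sum hx)
    _ = 4 * l ^ 2 / N + ε / 2 := by
        rw [Finset.sum_const, Finset.card_range, nsmul_eq_mul]; field_simp; ring
    _ < ε := by linarith

/-! ### Buchstab's identity and the existence of Dickman's limit. -/

theorem IsSmooth.mono {y z : ℝ} (hyz : y ≤ z) {n : ℤ} (h : IsSmooth y n) : IsSmooth z n :=
  fun p hp hd => (h p hp hd).trans hyz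

theorem smoothCount_mono {x y z : ℝ} (hyz : y ≤ z) : smoothCount x y ≤ smoothCount x z :=
  Finset.card_le_card (Finset.monotone_filter_right _ fun _ _ h => IsSmooth.mono hyz h)

theorem smoothCount_le {x : ℝ} (hx : 0 ≤ x) (y : ℝ) : (smoothCount x y : ℝ) ≤ x := by
  refine le_trans ?_ (Nat.floor_le hx)
  have := Finset.card_filter_le (Finset.Icc 1 ⌊x⌋₊) (fun n : ℕ => IsSmooth y (n : ℤ))
  rw [Nat.card_Icc, Nat.add_sub_cancel] at this
  exact_mod_cast this

theorem smoothCount_eq_floor {x y : ℝ} (hx : 0 ≤ x) (hxy : x ≤ y) : smoothCount x y = ⌊x⌋₊ := by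
  unfold smoothCount
  rw [Finset.filter_true_of_mem, Nat.card_Icc, Nat.add_sub_cancel]
  intro n hn p _ hd
  rw [Finset.mem_Icc, Nat.le_floor_iff hx] at hn
  have h1 : p ≤ n := Nat.le_of_dvd hn.1 (by exact_mod_cast hd)
  have h2 : (p : ℝ) ≤ n := by exact_mod_cast h1
  linarith [hn.2]

/-- Buchstab's identity: every positive integer `n ≤ x` that is not `y`-smooth is sorted by its
largest prime factor. -/
theorem buchstab {x y : ℝ} (hx : 0 ≤ x) (hy : 0 ≤ y) :
    smoothCount x y + ∑ p ∈ primesIoc y x, smoothCount (x / p) p = ⌊x⌋₊ := by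
  have h0 := Finset.card_filter_add_card_filter_not (s := Finset.Icc 1 ⌊x⌋₊)
    (fun n : ℕ => IsSmooth y (n : ℤ))
  rw [Nat.card_Icc, Nat.add_sub_cancel] at h0
  rw [← h0, smoothCount]
  congr 1
  have hsup : ∀ n : ℕ, ∀ p : ℕ, p.Prime → p ∣ n → n ≠ 0 → p ≤ n.primeFactors.sup id :=
    fun n p hp hd hn => Finset.le_sup (f := id) (Nat.mem_primeFactors.2 ⟨hp, hd, hn⟩)
  have hsup' : ∀ n : ℕ, 2 ≤ n → (n.primeFactors.sup id).Prime ∧ n.primeFactors.sup id ∣ n := by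
    intro n hn
    have hne : n.primeFactors.Nonempty := Nat.nonempty_primeFactors.2 (by omega)
    obtain ⟨q, hq, hq'⟩ := Finset.exists_mem_eq_sup _ hne id
    rw [hq']
    exact ⟨Nat.prime_of_mem_primeFactors hq, Nat.dvd_of_mem_primeFactors hq⟩
  rw [Finset.card_eq_sum_card_fiberwise (f := fun n : ℕ => n.primeFactors.sup id)
    (t := primesIoc y x)]
  · refine Finset.sum_congr rfl fun p hp => ?_
    rw [mem_primesIoc hy] at hp
    obtain ⟨hpp, hyp, hpx⟩ := hp
    have hp0 : (0 : ℝ) < p := by exact_mod_cast hpp.pos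
    unfold smoothCount
    -- The fibre over `p` consists of the `p * m` with `m ≤ x / p` and `m` `p`-smooth; `p` may
    -- divide `m` again.
    rw [← Finset.card_image_of_injective _ (mul_right_injective₀ hpp.ne_zero)]
    congr 1
    ext n
    simp only [Finset.mem_image, Finset.mem_filter, Finset.mem_Icc, Nat.le_floor_iff hx]
    constructor
    · rintro ⟨m, ⟨⟨hm1, hm2⟩, hm3⟩, rfl⟩
      rw [Nat.le_floor_iff (by positivity), le_div_iff₀ hp0] at hm2
      have hm0 : p * m ≠ 0 := by have := hpp.pos; positivity
      refine ⟨⟨⟨Nat.one_le_iff_ne_zero.2 hm0, by push_cast; linarith⟩, fun h => ?_⟩, ?_⟩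
      · have := h p hpp (by push_cast; exact dvd_mul_right _ _)
        linarith
      · apply le_antisymm
        · refine Finset.sup_le fun q hq => ?_
          obtain ⟨hq1, hq2, -⟩ := Nat.mem_primeFactors.1 hq
          rcases (hq1.dvd_mul).1 hq2 with h | h
          · exact Nat.le_of_dvd hpp.pos h
          · have := hm3 q hq1 (by exact_mod_cast h)
            exact_mod_cast this
        · exact hsup _ p hpp (dvd_mul_right _ _) hm0
    · rintro ⟨⟨⟨hn1, hn2⟩, hn3⟩, hn4⟩
      have hn : 2 ≤ n := by
        by_contra hlt
        have : n = 1 := by omega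
        subst this
        simp at hn4
        exact hpp.ne_zero hn4.symm
      obtain ⟨-, m, rfl⟩ := hn4 ▸ hsup' n hn
      have hm : m ≠ 0 := by rintro rfl; simp at hn
      refine ⟨m, ⟨⟨by omega, ?_⟩, ?_⟩, rfl⟩
      · rw [Nat.le_floor_iff (by positivity), le_div_iff₀ hp0]
        push_cast at hn2; linarith
      · intro q hq hqd
        have := hsup (p * m) q hq (dvd_mul_of_dvd_right (by exact_mod_cast hqd) _) (by omega)
        rw [hn4] at this
        exact_mod_cast this
  · intro n hn
    simp only [Finset.coe_filter, Finset.mem_Icc, Set.mem_ofPred_eq, Nat.le_floor_iff hx] at hn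
    obtain ⟨⟨hn1, hn2⟩, hn3⟩ := hn
    have : ∃ q : ℕ, q.Prime ∧ (q : ℤ) ∣ n ∧ y < q := by
      by_contra hne
      push Not at hne
      exact hn3 fun q hq hd => hne q hq hd
    obtain ⟨q, hq, hqd, hyq⟩ := this
    have hqd' : q ∣ n := by exact_mod_cast hqd
    have hn2' : 2 ≤ n := hq.two_le.trans (Nat.le_of_dvd hn1 hqd')
    obtain ⟨h1, h2⟩ := hsup' n hn2'
    have h3 := hsup n q hq hqd' (by omega)
    have h4 := Nat.le_of_dvd hn1 h2
    rw [Finset.mem_coe, mem_primesIoc hy]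
    refine ⟨h1, ?_, ?_⟩
    · refine hyq.trans_le ?_; exact_mod_cast h3
    · refine le_trans ?_ hn2; exact_mod_cast h4

/-- The proportion of `x^s`-smooth numbers up to `x`. -/
noncomputable def smoothDensity (s x : ℝ) : ℝ := (smoothCount x (x ^ s) : ℝ) / x

theorem smoothDensity_nonneg {s x : ℝ} (hx : 0 < x) : 0 ≤ smoothDensity s x := by
  unfold smoothDensity; positivity

theorem smoothDensity_le_one {s x : ℝ} (hx : 0 < x) : smoothDensity s x ≤ 1 := by
  unfold smoothDensity
  rw [div_le_one hx]
  exact smoothCount_le hx.le _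

theorem smoothDensity_mono {s t x : ℝ} (hx : 1 ≤ x) (hst : s ≤ t) :
    smoothDensity s x ≤ smoothDensity t x := by
  unfold smoothDensity
  gcongr
  exact smoothCount_mono (Real.rpow_le_rpow_of_exponent_le hx hst)

theorem exists_tendsto_of_forall_eventually_near {F : ℝ → ℝ}
    (h : ∀ ε > 0, ∃ c : ℝ, ∀ᶠ x in atTop, |F x - c| ≤ ε) : ∃ r, Tendsto F atTop (𝓝 r) := by
  apply cauchy_map_iff_exists_tendsto.1
  rw [Metric.cauchy_iff]
  refine ⟨inferInstance, fun ε hε => ?_⟩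
  obtain ⟨c, hc⟩ := h (ε / 3) (by positivity)
  refine ⟨{y | |y - c| ≤ ε / 3}, hc, fun a ha b hb => ?_⟩
  rw [Set.mem_ofPred_eq, abs_le] at ha hb
  rw [Real.dist_eq, abs_lt]
  constructor <;> linarith [ha.1, ha.2, hb.1, hb.2]

/-- With `X = x / p` and `p` in this range, `X ^ (τ / (1 - τ)) ≤ p ≤ X ^ (τ' / (1 - τ'))`. So the
count at `p` is trapped between two densities with fixed exponents, taken at a point `X ≥ x ^ (1 -
τ')`. -/
theorem buchstab_piece {τ τ' x ε r r' : ℝ} (hτ : 0 < τ) (hττ' : τ ≤ τ') (hτ' : τ' < 1)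
    (hx : 1 < x)
    (hr : ∀ X, x ^ (1 - τ') ≤ X → |smoothDensity (τ / (1 - τ)) X - r| ≤ ε)
    (hr' : ∀ X, x ^ (1 - τ') ≤ X → |smoothDensity (τ' / (1 - τ')) X - r'| ≤ ε) :
    (r - ε) * ∑ p ∈ primesIoc (x ^ τ) (x ^ τ'), (1 : ℝ) / p ≤
      ∑ p ∈ primesIoc (x ^ τ) (x ^ τ'), (smoothCount (x / p) p : ℝ) / x ∧
    ∑ p ∈ primesIoc (x ^ τ) (x ^ τ'), (smoothCount (x / p) p : ℝ) / x ≤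
      (r' + ε) * ∑ p ∈ primesIoc (x ^ τ) (x ^ τ'), (1 : ℝ) / p := by
  have hx0 : 0 < x := by linarith
  rw [Finset.mul_sum, Finset.mul_sum]
  have key : ∀ p ∈ primesIoc (x ^ τ) (x ^ τ'),
      (r - ε) * (1 / (p : ℝ)) ≤ (smoothCount (x / p) p : ℝ) / x ∧
      (smoothCount (x / p) p : ℝ) / x ≤ (r' + ε) * (1 / (p : ℝ)) := by
    intro p hp
    rw [mem_primesIoc (by positivity)] at hp
    obtain ⟨hpp, h1, h2⟩ := hp
    have hp0 : (0 : ℝ) < p := by exact_mod_cast hpp.pos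
    have hXlo : x ^ (1 - τ') ≤ x / p := by
      rw [Real.rpow_sub hx0, Real.rpow_one]; gcongr
    have hXhi : x / p ≤ x ^ (1 - τ) := by
      rw [Real.rpow_sub hx0, Real.rpow_one]; gcongr
    have hlo : (x / p) ^ (τ / (1 - τ)) ≤ p := by
      calc (x / p) ^ (τ / (1 - τ)) ≤ (x ^ (1 - τ)) ^ (τ / (1 - τ)) := by
            apply Real.rpow_le_rpow (by positivity) hXhi
            exact div_nonneg hτ.le (by linarith)
        _ = x ^ τ := by
            rw [← Real.rpow_mul hx0.le, mul_div_cancel₀]; linarith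
        _ ≤ p := h1.le
    have hhi : (p : ℝ) ≤ (x / p) ^ (τ' / (1 - τ')) := by
      calc (p : ℝ) ≤ x ^ τ' := h2
        _ = (x ^ (1 - τ')) ^ (τ' / (1 - τ')) := by
            rw [← Real.rpow_mul hx0.le, mul_div_cancel₀]; linarith
        _ ≤ (x / p) ^ (τ' / (1 - τ')) := by
            apply Real.rpow_le_rpow (by positivity) hXlo
            exact div_nonneg (by linarith) (by linarith)
    have e1 := (abs_le.1 (hr _ hXlo)).1
    have e2 := (abs_le.1 (hr' _ hXlo)).2
    unfold smoothDensity at e1 e2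
    have hX : (0 : ℝ) < x / p := by positivity
    have m1 : (smoothCount (x / p) ((x / p) ^ (τ / (1 - τ))) : ℝ) ≤ smoothCount (x / p) p := by
      exact_mod_cast smoothCount_mono hlo
    have m2 : (smoothCount (x / p) p : ℝ) ≤
        smoothCount (x / p) ((x / p) ^ (τ' / (1 - τ'))) := by
      exact_mod_cast smoothCount_mono hhi
    have e3 : r - ε ≤ (smoothCount (x / p) ((x / p) ^ (τ / (1 - τ))) : ℝ) / (x / p) := by
      linarith
    have e4 : (smoothCount (x / p) ((x / p) ^ (τ' / (1 - τ'))) : ℝ) / (x / p) ≤ r' + ε := by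
      linarith
    rw [le_div_iff₀ hX] at e3
    rw [div_le_iff₀ hX] at e4
    rw [le_div_iff₀ hx0, div_le_iff₀ hx0]
    constructor
    · calc _ = (r - ε) * (x / p) := by ring
        _ ≤ _ := e3.trans m1
    · calc _ ≤ (r' + ε) * (x / p) := m2.trans e4
        _ = _ := by ring
  exact ⟨Finset.sum_le_sum fun p hp => (key p hp).1, Finset.sum_le_sum fun p hp => (key p hp).2⟩

theorem tendsto_floor_div : Tendsto (fun x : ℝ => (⌊x⌋₊ : ℝ) / x) atTop (𝓝 1) :=
  tendsto_nat_floor_div_atTop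

theorem exists_tendsto_smoothDensity_of_one_le {s : ℝ} (hs : 1 ≤ s) :
    ∃ r, Tendsto (smoothDensity s) atTop (𝓝 r) := by
  refine ⟨1, tendsto_floor_div.congr' ?_⟩
  filter_upwards [eventually_ge_atTop 1] with x hx
  unfold smoothDensity
  rw [smoothCount_eq_floor (by linarith)]
  calc x = x ^ (1 : ℝ) := (Real.rpow_one x).symm
    _ ≤ _ := Real.rpow_le_rpow_of_exponent_le hx hs

theorem sum_range_primesIoc_rpow {x : ℝ} (hx : 1 ≤ x) {τ : ℕ → ℝ} (hτ : Monotone τ) (f : ℕ → ℝ)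
    (n : ℕ) : ∑ i ∈ Finset.range n, ∑ p ∈ primesIoc (x ^ τ i) (x ^ τ (i + 1)), f p =
      ∑ p ∈ primesIoc (x ^ τ 0) (x ^ τ n), f p := by
  induction n with
  | zero => simp [primesIoc]
  | succ n ih =>
    rw [Finset.sum_range_succ, ih]
    exact sum_primesIoc_add (Real.rpow_le_rpow_of_exponent_le hx (hτ (Nat.zero_le _)))
      (Real.rpow_le_rpow_of_exponent_le hx (hτ (Nat.le_succ _))) _

/-- The primes in `(x ^ θ, x ^ β]` are cut into pieces of nearly equal reciprocal mass `c ≤ ε`, and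
on each piece the density is replaced by the limit `r i`. The resulting errors contain `r (i + 1) -
r i`, which telescopes because the limits are monotone and lie in `[0, 1]`, so no continuity of the
limit is needed. The bound `8 * ε` is `5 * ε` from the pieces, `2 * ε` from primes above `x ^ β` and
`ε` from the floor. -/
theorem smoothDensity_near {θ : ℝ} (hθ : 0 < θ) (hθ1 : θ < 1)
    (ih : ∀ s, θ / (1 - θ) ≤ s → ∃ r, Tendsto (smoothDensity s) atTop (𝓝 r))
    {ε : ℝ} (hε : 0 < ε) (hε1 : ε ≤ 1) :
    ∃ c : ℝ, ∀ᶠ x in atTop, |smoothDensity θ x - c| ≤ 8 * ε := by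
  -- the cut-off exponent `β` for the primes
  obtain ⟨β, hβ0, hβ1, hβε⟩ : ∃ β : ℝ, θ ≤ β ∧ β < 1 ∧ Real.log (1 / β) ≤ ε := by
    refine ⟨max θ (Real.exp (-ε)), le_max_left _ _, max_lt hθ1 ?_, ?_⟩
    · exact Real.exp_lt_one_iff.2 (by linarith)
    · rw [one_div, Real.log_inv, neg_le]
      exact (Real.le_log_iff_exp_le (by positivity)).2 (le_max_right _ _)
  have hβ : 0 < β := by linarith
  set l := Real.log (β / θ) with hl
  have hl0 : 0 ≤ l := Real.log_nonneg (by rw [le_div_iff₀ hθ]; linarith)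
  obtain ⟨N, hN⟩ := exists_nat_gt (l / ε)
  have hN0 : (0 : ℝ) < N := lt_of_le_of_lt (by positivity) hN
  have hc : l / N ≤ ε := by
    rw [div_lt_iff₀ hε] at hN
    rw [div_le_iff₀ hN0]; linarith
  have hc0 : 0 ≤ l / N := by positivity
  set c := l / N with hcdef
  -- The accuracy demanded on a single piece, so that all `N` pieces together cost `ε`.
  set ε' := ε / N with hε'
  have hε'0 : 0 < ε' := by positivity
  have hNε' : N * ε' = ε := by rw [hε']; field_simp
  have hε'1 : ε' ≤ ε := by
    have hN1 : (1 : ℝ) ≤ N := by exact_mod_cast Nat.one_le_iff_ne_zero.2 (by rintro rfl; simp at hN0)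
    exact div_le_self hε.le hN1
  set τ : ℕ → ℝ := fun i => θ * Real.exp (c * i) with hτ
  have hτmono : Monotone τ := by
    intro i j hij
    have : (i : ℝ) ≤ j := by exact_mod_cast hij
    simp only [hτ]
    gcongr
  have hτ0 : τ 0 = θ := by simp [hτ]
  have hτN : τ N = β := by
    simp only [hτ, hcdef]
    rw [div_mul_cancel₀ _ hN0.ne', hl, Real.exp_log (by positivity)]
    field_simp
  have hτpos : ∀ i, θ ≤ τ i := fun i => hτ0 ▸ hτmono (Nat.zero_le i)
  have hτβ : ∀ i, i ≤ N → τ i ≤ β := fun i hi => hτN ▸ hτmono hi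
  have hex : ∀ i : ℕ, ∃ r, i ≤ N →
      Tendsto (smoothDensity (τ i / (1 - τ i))) atTop (𝓝 r) := by
    intro i
    by_cases hi : i ≤ N
    · obtain ⟨r, hr⟩ := ih (τ i / (1 - τ i)) (by
        have h1 := hτβ i hi
        have h2 := hτpos i
        rw [div_le_div_iff₀ (by linarith) (by linarith)]
        nlinarith)
      exact ⟨r, fun _ => hr⟩
    · exact ⟨0, fun h => absurd h hi⟩
  choose r hr using hex
  have hr0 : ∀ i, i ≤ N → 0 ≤ r i := fun i hi =>
    ge_of_tendsto (hr i hi) ((eventually_gt_atTop 0).mono fun x hx => smoothDensity_nonneg hx)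
  have hr1 : ∀ i, i ≤ N → r i ≤ 1 := fun i hi =>
    le_of_tendsto (hr i hi) ((eventually_gt_atTop 0).mono fun x hx => smoothDensity_le_one hx)
  have hrmono : ∀ i, i + 1 ≤ N → r i ≤ r (i + 1) := by
    intro i hi
    refine le_of_tendsto_of_tendsto (hr i (by omega)) (hr (i + 1) hi) ?_
    filter_upwards [eventually_ge_atTop 1] with x hx
    refine smoothDensity_mono hx ?_
    have h1 := hτβ _ hi
    have h2 := hτmono (Nat.le_succ i)
    have h3 := hτpos i
    rw [div_le_div_iff₀ (by linarith) (by linarith)]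
    simp only [Nat.succ_eq_add_one] at h2
    nlinarith
  refine ⟨1 - ∑ i ∈ Finset.range N, c * r i, ?_⟩
  have ev1 : ∀ᶠ x : ℝ in atTop, ∀ i ∈ Finset.range (N + 1),
      ∀ X, x ^ (1 - β) ≤ X → |smoothDensity (τ i / (1 - τ i)) X - r i| ≤ ε' := by
    rw [eventually_all_finset]
    intro i hi
    have h := (Metric.tendsto_nhds.1 (hr i (by simpa [Nat.lt_succ_iff] using hi))) ε' hε'0
    have h2 := (tendsto_rpow_atTop (show 0 < 1 - β by linarith)).eventually
      (eventually_forall_ge_atTop.2 h)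
    filter_upwards [h2] with x hx X hX
    have := hx X hX
    rw [Real.dist_eq] at this
    exact this.le
  have ev2 : ∀ᶠ x : ℝ in atTop, ∀ i ∈ Finset.range N,
      |∑ p ∈ primesIoc (x ^ τ i) (x ^ τ (i + 1)), (1 : ℝ) / p - c| ≤ ε' := by
    rw [eventually_all_finset]
    intro i _
    have hlog : Real.log (τ (i + 1) / τ i) = c := by
      simp only [hτ]
      rw [mul_div_mul_left _ _ hθ.ne', ← Real.exp_sub, Real.log_exp]
      push_cast; ring
    have h := tendsto_sum_primesIoc_inv (hθ.trans_le (hτpos i)) (hτmono (Nat.le_succ i))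
    simp only [Nat.succ_eq_add_one] at h
    rw [hlog] at h
    filter_upwards [Metric.tendsto_nhds.1 h ε' hε'0] with x hx
    rw [Real.dist_eq] at hx
    exact hx.le
  have ev3 : ∀ᶠ x : ℝ in atTop, ∑ p ∈ primesIoc (x ^ β) x, (1 : ℝ) / p ≤ 2 * ε := by
    have h := tendsto_sum_primesIoc_inv hβ hβ1.le
    simp only [Real.rpow_one] at h
    exact h.eventually_le_const (by linarith)
  have ev4 : ∀ᶠ x : ℝ in atTop, |(⌊x⌋₊ : ℝ) / x - 1| ≤ ε := by
    filter_upwards [Metric.tendsto_nhds.1 tendsto_floor_div ε hε] with x hx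
    rw [Real.dist_eq] at hx
    exact hx.le
  filter_upwards [ev1, ev2, ev3, ev4, eventually_gt_atTop 1] with x h1 h2 h3 h4 hx
  have hx0 : 0 < x := by linarith
  have hB : smoothDensity θ x = (⌊x⌋₊ : ℝ) / x -
      (∑ i ∈ Finset.range N, ∑ p ∈ primesIoc (x ^ τ i) (x ^ τ (i + 1)),
        (smoothCount (x / p) p : ℝ) / x) -
      ∑ p ∈ primesIoc (x ^ β) x, (smoothCount (x / p) p : ℝ) / x := by
    rw [sum_range_primesIoc_rpow hx.le hτmono (fun p => (smoothCount (x / p) p : ℝ) / x),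
      hτ0, hτN, sub_sub, sum_primesIoc_add, ← Finset.sum_div, smoothDensity, ← sub_div]
    · have := buchstab hx0.le (y := x ^ θ) (by positivity)
      rw [← this]; push_cast; ring
    · exact Real.rpow_le_rpow_of_exponent_le hx.le hβ0
    · calc x ^ β ≤ x ^ (1 : ℝ) := Real.rpow_le_rpow_of_exponent_le hx.le hβ1.le
        _ = x := Real.rpow_one x
  have htail0 : 0 ≤ ∑ p ∈ primesIoc (x ^ β) x, (smoothCount (x / p) p : ℝ) / x :=
    Finset.sum_nonneg fun p _ => by positivity
  have htail1 : ∑ p ∈ primesIoc (x ^ β) x, (smoothCount (x / p) p : ℝ) / x ≤ 2 * ε := by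
    refine le_trans (Finset.sum_le_sum fun p _ => ?_) h3
    rw [div_le_iff₀ hx0, one_div_mul_eq_div]
    exact smoothCount_le (by positivity) _
  have hpieces : ∀ i ∈ Finset.range N,
      |∑ p ∈ primesIoc (x ^ τ i) (x ^ τ (i + 1)), (smoothCount (x / p) p : ℝ) / x - c * r i| ≤
        2 * ε * (r (i + 1) - r i) + (2 * ε * ε' + ε') := by
    intro i hi
    have hi' : i + 1 ≤ N := by simpa [Nat.succ_le_iff] using hi
    have hX : ∀ X, x ^ (1 - τ (i + 1)) ≤ X → x ^ (1 - β) ≤ X := fun X hX =>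
      (Real.rpow_le_rpow_of_exponent_le hx.le (by linarith [hτβ _ hi'])).trans hX
    have hp := buchstab_piece (hθ.trans_le (hτpos i)) (hτmono (Nat.le_succ i))
      ((hτβ _ hi').trans_lt hβ1) hx
      (fun X h => h1 i (by simp; omega) X (hX X h))
      (fun X h => h1 (i + 1) (by simp; omega) X (hX X h))
    simp only [Nat.succ_eq_add_one] at hp
    have hm := abs_le.1 (h2 i hi)
    set m := ∑ p ∈ primesIoc (x ^ τ i) (x ^ τ (i + 1)), (1 : ℝ) / p
    set b := ∑ p ∈ primesIoc (x ^ τ i) (x ^ τ (i + 1)), (smoothCount (x / p) p : ℝ) / x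
    have hm0 : 0 ≤ m := Finset.sum_nonneg fun p _ => by positivity
    have hm2 : m ≤ 2 * ε := by linarith
    have q0 := hr0 i (by omega)
    have q1 := hr1 i (by omega)
    have q2 := hrmono i hi'
    have k1 : |(m - c) * r i| ≤ ε' := by
      rw [abs_mul, abs_of_nonneg q0]
      calc |m - c| * r i ≤ ε' * 1 := by gcongr; exact h2 i hi
        _ = ε' := mul_one _
    rw [abs_le] at k1
    have k2 : m * ε' ≤ 2 * ε * ε' := by gcongr
    have k3 : m * (r (i + 1) - r i) ≤ 2 * ε * (r (i + 1) - r i) := by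
      apply mul_le_mul_of_nonneg_right hm2; linarith
    have k4 : 0 ≤ 2 * ε * (r (i + 1) - r i) := by
      apply mul_nonneg <;> linarith
    rw [abs_le]
    constructor <;> nlinarith [hp.1, hp.2]
  have hmain : |∑ i ∈ Finset.range N, ∑ p ∈ primesIoc (x ^ τ i) (x ^ τ (i + 1)),
        (smoothCount (x / p) p : ℝ) / x - ∑ i ∈ Finset.range N, c * r i| ≤ 5 * ε := by
    rw [← Finset.sum_sub_distrib]
    calc _ ≤ ∑ i ∈ Finset.range N, (2 * ε * (r (i + 1) - r i) + (2 * ε * ε' + ε')) :=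
          (Finset.abs_sum_le_sum_abs _ _).trans (Finset.sum_le_sum hpieces)
      _ = 2 * ε * (r N - r 0) + (2 * ε + 1) * (N * ε') := by
          rw [Finset.sum_add_distrib, ← Finset.mul_sum, Finset.sum_range_sub, Finset.sum_const,
            Finset.card_range, nsmul_eq_mul]
          ring
      _ ≤ 2 * ε * 1 + (2 * 1 + 1) * ε := by
          rw [hNε']
          gcongr
          linarith [hr1 N le_rfl, hr0 0 (Nat.zero_le _)]
      _ = 5 * ε := by ring
  rw [hB]
  rw [abs_le] at hmain h4 ⊢
  constructor <;> linarith [hmain.1, hmain.2, h4.1, h4.2]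

/-- Buchstab's identity passes from `s` to exponents at least `s / (1 - s)`. Since `s ≥ 1 / (k + 2)`
gives `s / (1 - s) ≥ 1 / (k + 1)`, induction on `k` reaches every positive `s`. -/
theorem exists_tendsto_smoothDensity {s : ℝ} (hs : 0 < s) :
    ∃ r, Tendsto (smoothDensity s) atTop (𝓝 r) := by
  have main : ∀ k : ℕ, ∀ s : ℝ, 1 / ((k : ℝ) + 1) ≤ s →
      ∃ r, Tendsto (smoothDensity s) atTop (𝓝 r) := by
    intro k
    induction k with
    | zero =>
      intro s hs
      exact exists_tendsto_smoothDensity_of_one_le (by simpa using hs)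
    | succ k ih =>
      intro s hs
      rcases le_or_gt 1 s with h | h
      · exact exists_tendsto_smoothDensity_of_one_le h
      have hs0 : 0 < s := lt_of_lt_of_le (by positivity) hs
      refine exists_tendsto_of_forall_eventually_near fun ε hε => ?_
      have hk : 1 / ((k : ℝ) + 1) ≤ s / (1 - s) := by
        push_cast at hs
        rw [div_le_iff₀ (by positivity)] at hs
        rw [div_le_div_iff₀ (by positivity) (by linarith)]
        linarith
      obtain ⟨c, hc⟩ := smoothDensity_near hs0 h (fun t ht => ih t (hk.trans ht))
        (ε := min (ε / 8) 1) (by positivity) (min_le_right _ _)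
      refine ⟨c, hc.mono fun x hx => hx.trans ?_⟩
      linarith [min_le_left (ε / 8) 1]
  obtain ⟨k, hk⟩ := exists_nat_one_div_lt hs
  exact main k s hk.le

/-! ### Rough divisors and truncated Möbius sums. -/

/-- The squarefree integers `1 ≤ d ≤ Q` all of whose prime factors exceed `y`. -/
noncomputable def roughSet (y Q : ℝ) : Finset ℕ :=
  open Classical in
  (Finset.Icc 1 ⌊Q⌋₊).filter (fun d => Squarefree d ∧ ∀ p : ℕ, p.Prime → p ∣ d → y < p)

theorem mem_roughSet {y Q : ℝ} {d : ℕ} : d ∈ roughSet y Q ↔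
    (d : ℝ) ≤ Q ∧ Squarefree d ∧ ∀ p : ℕ, p.Prime → p ∣ d → y < p := by
  simp only [roughSet, Finset.mem_filter, Finset.mem_Icc]
  constructor
  · rintro ⟨⟨h1, h2⟩, h3⟩
    exact ⟨(Nat.le_floor_iff' (by omega)).1 h2, h3⟩
  · rintro ⟨h2, h3⟩
    exact ⟨⟨Nat.pos_of_ne_zero h3.1.ne_zero, (Nat.le_floor_iff' h3.1.ne_zero).2 h2⟩, h3⟩

theorem roughSet_subset {y u Q : ℝ} (h : y ≤ u) : roughSet u Q ⊆ roughSet y Q := by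
  intro d hd
  rw [mem_roughSet] at hd ⊢
  exact ⟨hd.1, hd.2.1, fun p hp hpd => h.trans_lt (hd.2.2 p hp hpd)⟩

/-- The product of the primes larger than `u` that divide `n`. -/
noncomputable def largePart (u : ℝ) (n : ℤ) : ℕ :=
  ∏ p ∈ n.natAbs.primeFactors.filter (fun p : ℕ => u < p), p

theorem primeFactors_largePart (u : ℝ) (n : ℤ) :
    (largePart u n).primeFactors = n.natAbs.primeFactors.filter (fun p : ℕ => u < p) :=
  Nat.primeFactors_prod fun _ hp => Nat.prime_of_mem_primeFactors (Finset.filter_subset _ _ hp)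

theorem squarefree_largePart (u : ℝ) (n : ℤ) : Squarefree (largePart u n) := by
  refine Squarefree.squarefree_of_dvd ?_
    (UniqueFactorizationMonoid.squarefree_radical (a := n.natAbs))
  rw [Nat.radical_eq_prod_primeFactors]
  exact Finset.prod_dvd_prod_of_subset _ _ _ (Finset.filter_subset _ _)

theorem largePart_dvd (u : ℝ) (n : ℤ) : largePart u n ∣ n.natAbs :=
  (Finset.prod_dvd_prod_of_subset _ _ _ (Finset.filter_subset _ _)).trans
    (Nat.prod_primeFactors_dvd _)

/-- The rough squarefree divisors of `n` are thus all the divisors of a single number, so their full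
Möbius sum collapses. For `n = 0` this fails: `Nat.primeFactors 0` is empty and the large part is 1.
-/
theorem dvd_largePart_iff {u : ℝ} {n : ℤ} (hn : n ≠ 0) {d : ℕ} : d ∣ largePart u n ↔
    Squarefree d ∧ (∀ p : ℕ, p.Prime → p ∣ d → u < p) ∧ (d : ℤ) ∣ n := by
  constructor
  · intro h
    refine ⟨(squarefree_largePart u n).squarefree_of_dvd h, fun p hp hpd => ?_, ?_⟩
    · have : p ∈ (largePart u n).primeFactors :=
        Nat.mem_primeFactors.2 ⟨hp, hpd.trans h, (squarefree_largePart u n).ne_zero⟩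
      rw [primeFactors_largePart, Finset.mem_filter] at this
      exact this.2
    · exact Int.natCast_dvd.2 (h.trans (largePart_dvd u n))
  · rintro ⟨h1, h2, h3⟩
    rw [← Nat.prod_primeFactors_of_squarefree h1]
    apply Finset.prod_dvd_prod_of_subset
    intro p hp
    rw [Nat.mem_primeFactors] at hp
    rw [Finset.mem_filter, Nat.mem_primeFactors]
    exact ⟨⟨hp.1, hp.2.1.trans (Int.natCast_dvd.1 h3), by simpa using hn⟩, h2 p hp.1 hp.2.1⟩

theorem largePart_eq_one_iff {u : ℝ} {n : ℤ} (hn : n ≠ 0) :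
    largePart u n = 1 ↔ IsSmooth u n := by
  rw [Nat.eq_one_iff_not_exists_prime_dvd]
  refine forall₂_congr fun p hp => ?_
  rw [dvd_largePart_iff hn]
  constructor
  · intro h hd
    by_contra hlt
    refine h ⟨hp.prime.squarefree, fun q hq hqd => ?_, hd⟩
    rw [(Nat.prime_dvd_prime_iff_eq hq hp).1 hqd]
    exact not_le.1 hlt
  · rintro h ⟨-, h2, h3⟩
    exact absurd (h2 p hp dvd_rfl) (not_lt.2 (h h3))

theorem sum_moebius_divisors (w : ℕ) :
    ∑ d ∈ w.divisors, (ArithmeticFunction.moebius d : ℝ) = if w = 1 then 1 else 0 := by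
  have h := congrArg (fun f : ArithmeticFunction ℤ => f w) ArithmeticFunction.moebius_mul_coe_zeta
  simp only [ArithmeticFunction.coe_mul_zeta_apply, ArithmeticFunction.one_apply] at h
  exact_mod_cast h

theorem card_divisors_le_of_squarefree {w : ℕ} (hw : Squarefree w) :
    w.divisors.card ≤ 2 ^ w.primeFactors.card := by
  rw [Nat.card_divisors hw.ne_zero]
  refine Finset.prod_le_pow_card _ _ _ fun p _ => ?_
  have := hw.natFactorization_le_one p
  omega

/-- More than `K` primes above `u` would force `|n| ≥ u ^ K > X`. For `u` a fixed power of `x` and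
`X = 2 * x`, `K` can be chosen independent of `x`. -/
theorem card_divisors_largePart_le {u X : ℝ} {K : ℕ} {n : ℤ} (hn : n ≠ 0) (hu : 1 ≤ u)
    (hX : |(n : ℝ)| ≤ X) (hK : X < u ^ K) : (largePart u n).divisors.card ≤ 2 ^ K := by
  refine (card_divisors_le_of_squarefree (squarefree_largePart u n)).trans ?_
  apply Nat.pow_le_pow_right (by norm_num)
  by_contra hlt
  rw [not_le, primeFactors_largePart] at hlt
  have h1 : (largePart u n : ℝ) ≤ |(n : ℝ)| := by
    have := Nat.le_of_dvd (Int.natAbs_pos.2 hn) (largePart_dvd u n)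
    rw [← Int.cast_abs, ← Int.natCast_natAbs]
    exact_mod_cast this
  have h2 : u ^ (n.natAbs.primeFactors.filter (fun p : ℕ => u < p)).card ≤ largePart u n := by
    rw [largePart, Nat.cast_prod, ← Finset.prod_const]
    refine Finset.prod_le_prod (fun _ _ => by linarith) fun p hp => ?_
    exact (Finset.mem_filter.1 hp).2.le
  have h3 : u ^ K ≤ u ^ (n.natAbs.primeFactors.filter (fun p : ℕ => u < p)).card :=
    pow_le_pow_right₀ hu hlt.le
  linarith

theorem filter_roughSet_dvd {u Q : ℝ} {n : ℤ} (hn : n ≠ 0) :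
    (roughSet u Q).filter (fun d : ℕ => (d : ℤ) ∣ n) =
      (largePart u n).divisors.filter (fun d : ℕ => (d : ℝ) ≤ Q) := by
  ext d
  simp only [Finset.mem_filter, mem_roughSet, Nat.mem_divisors, dvd_largePart_iff hn]
  have := (squarefree_largePart u n).ne_zero
  tauto

theorem abs_moebius_le_one_real (d : ℕ) : |(ArithmeticFunction.moebius d : ℝ)| ≤ 1 := by
  exact_mod_cast ArithmeticFunction.abs_moebius_le_one (n := d)

theorem abs_sum_moebius_roughSet_le {u Q X : ℝ} {K : ℕ} {n : ℤ} (hn : n ≠ 0) (hu : 1 ≤ u)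
    (hX : |(n : ℝ)| ≤ X) (hK : X < u ^ K) :
    |∑ d ∈ (roughSet u Q).filter (fun d : ℕ => (d : ℤ) ∣ n),
      (ArithmeticFunction.moebius d : ℝ)| ≤ 2 ^ K := by
  rw [filter_roughSet_dvd hn]
  calc _ ≤ ∑ d ∈ (largePart u n).divisors.filter (fun d : ℕ => (d : ℝ) ≤ Q), (1 : ℝ) :=
        (Finset.abs_sum_le_sum_abs _ _).trans
          (Finset.sum_le_sum fun d _ => abs_moebius_le_one_real d)
    _ ≤ (largePart u n).divisors.card := by
        rw [Finset.sum_const, nsmul_eq_mul, mul_one]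
        exact_mod_cast Finset.card_filter_le _ _
    _ ≤ 2 ^ K := by exact_mod_cast card_divisors_largePart_le hn hu hX hK

theorem sum_moebius_roughSet_eq {u Q : ℝ} {n : ℤ} (hn : n ≠ 0)
    (hQ : (largePart u n : ℝ) ≤ Q) :
    ∑ d ∈ (roughSet u Q).filter (fun d : ℕ => (d : ℤ) ∣ n),
      (ArithmeticFunction.moebius d : ℝ) = if IsSmooth u n then 1 else 0 := by
  rw [filter_roughSet_dvd hn, Finset.filter_true_of_mem, sum_moebius_divisors]
  · simp only [largePart_eq_one_iff hn]
  · intro d hd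
    refine le_trans ?_ hQ
    exact_mod_cast Nat.divisor_le hd

/-- A prime `p ≤ u` is coprime to the large part, so their product divides `n`. One medium-sized
prime factor therefore makes room for the truncation at `Q`. -/
theorem largePart_le_of_prime_dvd {u X : ℝ} {n : ℤ} (hn : n ≠ 0) (hX : |(n : ℝ)| ≤ X) {p : ℕ}
    (hp : p.Prime) (hpu : (p : ℝ) ≤ u) (hpn : (p : ℤ) ∣ n) : (largePart u n : ℝ) ≤ X / p := by
  have hp0 : (0 : ℝ) < p := by exact_mod_cast hp.pos
  rw [le_div_iff₀ hp0]
  have hcop : Nat.Coprime (largePart u n) p := by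
    rw [Nat.coprime_comm, hp.coprime_iff_not_dvd, dvd_largePart_iff hn]
    rintro ⟨-, h, -⟩
    linarith [h p hp dvd_rfl]
  have hd : largePart u n * p ∣ n.natAbs :=
    hcop.mul_dvd_of_dvd_of_dvd (largePart_dvd u n) (Int.natCast_dvd.1 hpn)
  have h1 := Nat.le_of_dvd (Int.natAbs_pos.2 hn) hd
  refine le_trans ?_ hX
  rw [← Int.cast_abs, ← Int.natCast_natAbs]
  exact_mod_cast h1

/-! ### The sieve for a family equidistributed on average. -/

section Sieve

variable {ι : Type*}

/-- The number of `i ∈ I` with `d ∣ n i`. -/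
noncomputable def dvdCount (I : Finset ι) (n : ι → ℤ) (d : ℕ) : ℝ :=
  ∑ i ∈ I, if (d : ℤ) ∣ n i then (1 : ℝ) else 0

/-- By unique factorization a modulus `d` equals `p * q` for at most one unordered pair, that is two
ordered ones. -/
theorem sum_offDiag_mul_le {P D : Finset ℕ} (hP : ∀ p ∈ P, p.Prime)
    (hD : ∀ p ∈ P, ∀ q ∈ P, p ≠ q → p * q ∈ D) {e : ℕ → ℝ} (he : ∀ d, 0 ≤ e d) :
    ∑ p ∈ P, ∑ q ∈ P.erase p, e (p * q) ≤ 2 * ∑ d ∈ D, e d := by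
  have hlt : ∑ x ∈ (P ×ˢ P).filter (fun x => x.1 < x.2), e (x.1 * x.2) ≤ ∑ d ∈ D, e d := by
    rw [← Finset.sum_image (f := e) (g := fun x : ℕ × ℕ => x.1 * x.2)]
    · apply Finset.sum_le_sum_of_subset_of_nonneg _ fun _ _ _ => he _
      intro d hd
      simp only [Finset.mem_image, Finset.mem_filter, Finset.mem_product] at hd
      obtain ⟨x, ⟨⟨h1, h2⟩, h3⟩, rfl⟩ := hd
      exact hD _ h1 _ h2 h3.ne
    · rintro ⟨p, q⟩ hx ⟨p', q'⟩ hx' h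
      simp only [Finset.coe_filter, Finset.mem_product, Set.mem_ofPred_eq] at hx hx' h
      obtain ⟨⟨hp, hq⟩, hpq⟩ := hx
      obtain ⟨⟨hp', hq'⟩, hpq'⟩ := hx'
      have h1 : p ∣ p' * q' := h ▸ dvd_mul_right _ _
      have hpp' : p = p' := by
        rcases ((hP p hp).dvd_mul).1 h1 with h2 | h2
        · exact (Nat.prime_dvd_prime_iff_eq (hP p hp) (hP p' hp')).1 h2
        · have h3 := (Nat.prime_dvd_prime_iff_eq (hP p hp) (hP q' hq')).1 h2
          subst h3
          rw [mul_comm] at h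
          have := Nat.eq_of_mul_eq_mul_right (hP p hp).pos h
          omega
      subst hpp'
      rw [Nat.eq_of_mul_eq_mul_left (hP p hp).pos h]
  have hgt : ∑ x ∈ (P ×ˢ P).filter (fun x => x.2 < x.1), e (x.1 * x.2) =
      ∑ x ∈ (P ×ˢ P).filter (fun x => x.1 < x.2), e (x.1 * x.2) := by
    refine Finset.sum_nbij' Prod.swap Prod.swap ?_ ?_ ?_ ?_ ?_ <;>
      simp +contextual [mul_comm]
  have hsplit : ∑ p ∈ P, ∑ q ∈ P.erase p, e (p * q) =
      ∑ x ∈ (P ×ˢ P).filter (fun x => x.1 < x.2), e (x.1 * x.2) +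
      ∑ x ∈ (P ×ˢ P).filter (fun x => x.2 < x.1), e (x.1 * x.2) := by
    rw [Finset.sum_filter, Finset.sum_filter, ← Finset.sum_add_distrib, Finset.sum_product]
    refine Finset.sum_congr rfl fun p hp => ?_
    refine Eq.trans ?_ (Finset.sum_erase P (a := p) (by simp))
    refine Finset.sum_congr rfl fun q hq => ?_
    rcases lt_or_gt_of_ne (Finset.ne_of_mem_erase hq) with h | h
    · simp [h, h.not_gt]
    · simp [h, h.not_gt]
  rw [hsplit, hgt]
  linarith

/-- A Turán–Kubilius type bound: few `n i` are free of primes from `(y, z]`. -/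
theorem card_no_prime_le (I : Finset ι) (n : ι → ℤ) {T E y z Q L : ℝ} (hT : 0 ≤ T) (hy : 0 ≤ y)
    (hz1 : 1 ≤ z) (hz : z ^ 2 ≤ Q)
    (hE : ∑ d ∈ roughSet y Q, |dvdCount I n d - T / d| ≤ E)
    (hL : L = ∑ p ∈ primesIoc y z, (1 : ℝ) / p) (hL1 : 1 ≤ L) :
    ∑ i ∈ I, (if ∀ p ∈ primesIoc y z, ¬ (p : ℤ) ∣ n i then (1 : ℝ) else 0) ≤ T / L + 6 * E := by
  set P := primesIoc y z with hPdef
  have hP : ∀ p ∈ P, p.Prime := fun p hp => ((mem_primesIoc hy).1 hp).1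
  set e : ℕ → ℝ := fun d => |dvdCount I n d - T / d| with he
  have he0 : ∀ d, 0 ≤ e d := fun d => abs_nonneg _
  have hE0 : 0 ≤ E := (Finset.sum_nonneg fun d _ => he0 d).trans hE
  have hzz : z ≤ z ^ 2 := by nlinarith
  have hPmem : ∀ p ∈ P, p ∈ roughSet y Q := by
    intro p hp
    have h := (mem_primesIoc hy).1 hp
    rw [mem_roughSet]
    refine ⟨by linarith [h.2.2], h.1.prime.squarefree, fun q hq hqd => ?_⟩
    rw [(Nat.prime_dvd_prime_iff_eq hq h.1).1 hqd]
    exact h.2.1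
  have hPPmem : ∀ p ∈ P, ∀ q ∈ P, p ≠ q → p * q ∈ roughSet y Q := by
    intro p hp q hq hpq
    have h := (mem_primesIoc hy).1 hp
    have h' := (mem_primesIoc hy).1 hq
    rw [mem_roughSet]
    refine ⟨?_, ?_, fun r hr hrd => ?_⟩
    · push_cast
      have : (p : ℝ) * q ≤ z * z := by gcongr; exacts [h.2.2, h'.2.2]
      nlinarith
    · rw [Nat.squarefree_mul ((Nat.coprime_primes h.1 h'.1).2 hpq)]
      exact ⟨h.1.prime.squarefree, h'.1.prime.squarefree⟩
    · rcases (hr.dvd_mul).1 hrd with h2 | h2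
      · rw [(Nat.prime_dvd_prime_iff_eq hr h.1).1 h2]; exact h.2.1
      · rw [(Nat.prime_dvd_prime_iff_eq hr h'.1).1 h2]; exact h'.2.1
  have hone : 1 ∈ roughSet y Q := by
    rw [mem_roughSet]
    refine ⟨by push_cast; linarith, squarefree_one, fun p hp hpd => ?_⟩
    exact absurd (Nat.dvd_one.1 hpd) hp.ne_one
  set a : ℕ → ι → ℝ := fun d i => if (d : ℤ) ∣ n i then (1 : ℝ) else 0 with ha
  have hcount : ∀ d, dvdCount I n d = ∑ i ∈ I, a d i := fun d => rfl
  have hupper : ∀ d, dvdCount I n d ≤ T / d + e d := fun d => by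
    linarith [le_abs_self (dvdCount I n d - T / d)]
  have hlower : ∀ d, T / d - e d ≤ dvdCount I n d := fun d => by
    linarith [neg_abs_le (dvdCount I n d - T / d)]
  -- `g i` counts the primes of `P` dividing `n i`. It should be close to `L` on average, so its
  -- variance about `L` is bounded, and Chebyshev's inequality is applied where `g i = 0`.
  set g : ι → ℝ := fun i => ∑ p ∈ P, a p i with hg
  have hsq : ∀ i, g i ^ 2 = ∑ p ∈ P, ∑ q ∈ P.erase p, a (p * q) i + ∑ p ∈ P, a p i := by
    intro i
    rw [sq, hg, Finset.sum_mul_sum, ← Finset.sum_add_distrib]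
    refine Finset.sum_congr rfl fun p hp => ?_
    rw [← Finset.sum_erase_add _ _ hp]
    congr 1
    · refine Finset.sum_congr rfl fun q hq => ?_
      obtain ⟨hqp, hq⟩ := Finset.mem_erase.1 hq
      have hcop : IsCoprime (p : ℤ) (q : ℤ) := by
        rw [Nat.isCoprime_iff_coprime]
        exact (Nat.coprime_primes (hP p hp) (hP q hq)).2 hqp.symm
      have hiff : ((p * q : ℕ) : ℤ) ∣ n i ↔ (p : ℤ) ∣ n i ∧ (q : ℤ) ∣ n i := by
        push_cast
        exact ⟨fun h => ⟨(dvd_mul_right _ _).trans h, (dvd_mul_left _ _).trans h⟩,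
          fun h => hcop.mul_dvd h.1 h.2⟩
      simp only [ha, hiff]
      by_cases h1 : (p : ℤ) ∣ n i <;> by_cases h2 : (q : ℤ) ∣ n i <;> simp [h1, h2]
    · simp only [ha]
      by_cases h1 : (p : ℤ) ∣ n i <;> simp [h1]
  have hsum1 : ∑ i ∈ I, g i = ∑ p ∈ P, dvdCount I n p := by
    simp only [hg, hcount]; exact Finset.sum_comm
  have hsum2 : ∑ i ∈ I, g i ^ 2 =
      ∑ p ∈ P, ∑ q ∈ P.erase p, dvdCount I n (p * q) + ∑ p ∈ P, dvdCount I n p := by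
    simp only [hsq, Finset.sum_add_distrib, hcount]
    rw [Finset.sum_comm (s := I) (t := P), Finset.sum_comm (s := I) (t := P)]
    congr 1
    exact Finset.sum_congr rfl fun p _ => Finset.sum_comm
  have hcard : (∑ i ∈ I, (1 : ℝ)) = dvdCount I n 1 := by simp [dvdCount]
  have hvar : ∑ i ∈ I, (g i - L) ^ 2 =
      ∑ p ∈ P, ∑ q ∈ P.erase p, dvdCount I n (p * q) + ∑ p ∈ P, dvdCount I n p
        - 2 * L * ∑ p ∈ P, dvdCount I n p + L ^ 2 * dvdCount I n 1 := by
    rw [← hsum2, ← hsum1, ← hcard, Finset.mul_sum, Finset.mul_sum, ← Finset.sum_sub_distrib,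
      ← Finset.sum_add_distrib]
    exact Finset.sum_congr rfl fun i _ => by ring
  have hTP : ∑ p ∈ P, T / p = T * L := by
    rw [hL, Finset.mul_sum]; exact Finset.sum_congr rfl fun p _ => by ring
  have hEP : ∑ p ∈ P, e p ≤ E :=
    (Finset.sum_le_sum_of_subset_of_nonneg hPmem fun _ _ _ => he0 _).trans hE
  have hoff : ∑ p ∈ P, ∑ q ∈ P.erase p, dvdCount I n (p * q) ≤ T * L ^ 2 + 2 * E := by
    calc _ ≤ ∑ p ∈ P, ∑ q ∈ P.erase p, (T / (p * q : ℕ) + e (p * q)) :=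
          Finset.sum_le_sum fun p _ => Finset.sum_le_sum fun q _ => hupper _
      _ = ∑ p ∈ P, ∑ q ∈ P.erase p, T / (p * q : ℕ) + ∑ p ∈ P, ∑ q ∈ P.erase p, e (p * q) := by
          simp only [Finset.sum_add_distrib]
      _ ≤ ∑ p ∈ P, ∑ q ∈ P, T / (p * q : ℕ) + 2 * E := by
          gcongr with p hp
          · exact Finset.erase_subset _ _
          · exact (sum_offDiag_mul_le hP hPPmem he0).trans (by linarith)
      _ = T * L ^ 2 + 2 * E := by
          rw [sq, hL, Finset.sum_mul_sum, Finset.mul_sum]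
          congr 1
          refine Finset.sum_congr rfl fun p _ => ?_
          rw [Finset.mul_sum]
          refine Finset.sum_congr rfl fun q _ => ?_
          push_cast
          rw [one_div_mul_one_div, mul_one_div]
  have hdiag : ∑ p ∈ P, dvdCount I n p ≤ T * L + E := by
    calc _ ≤ ∑ p ∈ P, (T / p + e p) := Finset.sum_le_sum fun p _ => hupper p
      _ ≤ T * L + E := by rw [Finset.sum_add_distrib, hTP]; linarith
  have hdiag' : T * L - E ≤ ∑ p ∈ P, dvdCount I n p := by
    calc T * L - E ≤ ∑ p ∈ P, (T / p - e p) := by rw [Finset.sum_sub_distrib, hTP]; linarith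
      _ ≤ _ := Finset.sum_le_sum fun p _ => hlower p
  have hcard' : dvdCount I n 1 ≤ T + E := by
    have h1 : e 1 ≤ E := (Finset.single_le_sum (fun d _ => he0 d) hone).trans hE
    have h2 := hupper 1
    rw [Nat.cast_one, div_one] at h2
    linarith
  have hLpos : 0 < L := by linarith
  -- The terms in `T * L ^ 2` cancel. The errors `2 * E + E + 2 * L * E + L ^ 2 * E` are at most `6
  -- * E * L ^ 2` because `1 ≤ L`.
  have hbound : ∑ i ∈ I, (g i - L) ^ 2 ≤ T * L + 6 * E * L ^ 2 := by
    rw [hvar]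
    have h1 : 2 * L * (T * L - E) ≤ 2 * L * ∑ p ∈ P, dvdCount I n p := by gcongr
    have h2 : L ^ 2 * dvdCount I n 1 ≤ L ^ 2 * (T + E) := by gcongr
    have h3 : E ≤ E * L := le_mul_of_one_le_right hE0 hL1
    have h4 : E * L ≤ E * L ^ 2 := by
      have : L ≤ L ^ 2 := by nlinarith
      gcongr
    nlinarith
  have hfinal : L ^ 2 * ∑ i ∈ I, (if ∀ p ∈ P, ¬ (p : ℤ) ∣ n i then (1 : ℝ) else 0) ≤
      ∑ i ∈ I, (g i - L) ^ 2 := by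
    rw [Finset.mul_sum]
    refine Finset.sum_le_sum fun i _ => ?_
    split_ifs with h
    · have : g i = 0 := Finset.sum_eq_zero fun p hp => by simp [ha, h p hp]
      rw [this]; simp
    · simpa using sq_nonneg _
  have h5 : L ^ 2 * ∑ i ∈ I, (if ∀ p ∈ P, ¬ (p : ℤ) ∣ n i then (1 : ℝ) else 0) ≤
      L ^ 2 * (T / L + 6 * E) := by
    refine hfinal.trans (hbound.trans (le_of_eq ?_))
    field_simp
  exact le_of_mul_le_mul_left h5 (by positivity)

/-- Smooth values are counted by an inclusion–exclusion sum over moduli up to `Q`, with an error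
controlled by the equidistribution of the `n i` modulo rough moduli. -/
theorem abs_smooth_sub_le (I : Finset ι) (n : ι → ℤ) {T E y z u Q X L : ℝ} {K : ℕ}
    (hn : ∀ i ∈ I, n i ≠ 0) (hnX : ∀ i ∈ I, |(n i : ℝ)| ≤ X)
    (hT : 0 ≤ T) (hy : 0 < y) (hyz : y ≤ z) (hz1 : 1 ≤ z) (hzu : z ≤ u) (hz : z ^ 2 ≤ Q)
    (hXQ : X ≤ Q * y) (hK : X < u ^ K)
    (hE : ∑ d ∈ roughSet y Q, |dvdCount I n d - T / d| ≤ E)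
    (hL : L = ∑ p ∈ primesIoc y z, (1 : ℝ) / p) (hL1 : 1 ≤ L) :
    |∑ i ∈ I, (if IsSmooth u (n i) then (1 : ℝ) else 0) -
      T * ∑ d ∈ roughSet u Q, (ArithmeticFunction.moebius d : ℝ) / d| ≤
      E + (1 + 2 ^ K) * (T / L + 6 * E) := by
  set F : ι → ℝ := fun i => ∑ d ∈ (roughSet u Q).filter (fun d : ℕ => (d : ℤ) ∣ n i),
      (ArithmeticFunction.moebius d : ℝ) with hF
  -- If some prime of `(y, z]` divides `n i`, the truncated sum `F i` is exactly the indicator.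
  -- Otherwise the two differ by at most `1 + 2 ^ K`, and such `i` are rare.
  have h1 : |∑ i ∈ I, (if IsSmooth u (n i) then (1 : ℝ) else 0) - ∑ i ∈ I, F i| ≤
      (1 + 2 ^ K) * (T / L + 6 * E) := by
    rw [← Finset.sum_sub_distrib]
    refine (Finset.abs_sum_le_sum_abs _ _).trans ?_
    refine le_trans ?_ (mul_le_mul_of_nonneg_left
      (card_no_prime_le I n hT hy.le hz1 hz hE hL hL1) (by positivity))
    rw [Finset.mul_sum]
    refine Finset.sum_le_sum fun i hi => ?_
    split_ifs with h1 h2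
    · calc |1 - F i| ≤ |(1 : ℝ)| + |F i| := abs_sub _ _
        _ ≤ (1 + 2 ^ K) * 1 := by
          rw [abs_one, mul_one]
          gcongr
          exact abs_sum_moebius_roughSet_le (hn i hi) (hz1.trans hzu) (hnX i hi) hK
    · push Not at h2
      obtain ⟨p, hp, hpn⟩ := h2
      rw [mem_primesIoc hy.le] at hp
      have := sum_moebius_roughSet_eq (u := u) (Q := Q) (hn i hi)
        ((largePart_le_of_prime_dvd (hn i hi) (hnX i hi) hp.1 (hp.2.2.trans hzu) hpn).trans ?_)
      · simp only [hF, this, if_pos h1]; simp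
      · have hp0 : (0 : ℝ) < p := hy.trans hp.2.1
        rw [div_le_iff₀ hp0]
        refine hXQ.trans ?_
        gcongr
        · nlinarith
        · exact hp.2.1.le
    · rw [zero_sub, abs_neg]
      calc |F i| ≤ 2 ^ K := abs_sum_moebius_roughSet_le (hn i hi) (hz1.trans hzu) (hnX i hi) hK
        _ ≤ (1 + 2 ^ K) * 1 := by linarith
    · rename_i h2
      push Not at h2
      obtain ⟨p, hp, hpn⟩ := h2
      rw [mem_primesIoc hy.le] at hp
      have := sum_moebius_roughSet_eq (u := u) (Q := Q) (hn i hi)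
        ((largePart_le_of_prime_dvd (hn i hi) (hnX i hi) hp.1 (hp.2.2.trans hzu) hpn).trans ?_)
      · simp only [hF, this, if_neg h1]; simp
      · have hp0 : (0 : ℝ) < p := hy.trans hp.2.1
        rw [div_le_iff₀ hp0]
        refine hXQ.trans ?_
        gcongr
        · nlinarith
        · exact hp.2.1.le
  have h2 : |∑ i ∈ I, F i - T * ∑ d ∈ roughSet u Q, (ArithmeticFunction.moebius d : ℝ) / d| ≤
      E := by
    have hFsum : ∑ i ∈ I, F i =
        ∑ d ∈ roughSet u Q, (ArithmeticFunction.moebius d : ℝ) * dvdCount I n d := by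
      simp only [hF, dvdCount, Finset.mul_sum, Finset.sum_filter, mul_ite, mul_one, mul_zero]
      exact Finset.sum_comm
    rw [hFsum, Finset.mul_sum, ← Finset.sum_sub_distrib]
    refine (Finset.abs_sum_le_sum_abs _ _).trans (le_trans ?_ hE)
    refine le_trans (Finset.sum_le_sum fun d _ => ?_)
      (Finset.sum_le_sum_of_subset_of_nonneg (roughSet_subset (hyz.trans hzu))
        fun _ _ _ => abs_nonneg _)
    rw [show (ArithmeticFunction.moebius d : ℝ) * dvdCount I n d -
      T * ((ArithmeticFunction.moebius d : ℝ) / d) =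
      (ArithmeticFunction.moebius d : ℝ) * (dvdCount I n d - T / d) by ring, abs_mul]
    exact mul_le_of_le_one_left (abs_nonneg _) (abs_moebius_le_one_real d)
  calc _ ≤ _ := abs_sub_le _ (∑ i ∈ I, F i) _
    _ ≤ _ := by linarith

end Sieve

/-! ### Exponential sums and the large sieve. -/

/-- The additive character `t ↦ exp (2πit)`. -/
noncomputable def expo (t : ℝ) : ℂ := Complex.exp (2 * Real.pi * t * Complex.I)

theorem expo_add (s t : ℝ) : expo (s + t) = expo s * expo t := by
  rw [expo, expo, expo, ← Complex.exp_add]; congr 1; push_cast; ring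

theorem expo_zero : expo 0 = 1 := by simp [expo]

theorem expo_nat_mul (n : ℕ) (t : ℝ) : expo (n * t) = expo t ^ n := by
  rw [expo, expo, ← Complex.exp_nat_mul]; congr 1; push_cast; ring

theorem norm_expo (t : ℝ) : ‖expo t‖ = 1 := by
  rw [expo, show (2 * Real.pi * t * Complex.I : ℂ) = ((2 * Real.pi * t : ℝ) : ℂ) * Complex.I by
    push_cast; ring]
  exact Complex.norm_exp_ofReal_mul_I _

theorem star_expo (t : ℝ) : (starRingEnd ℂ) (expo t) = expo (-t) := by
  rw [expo, expo, ← Complex.exp_conj]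
  congr 1
  rw [map_mul, map_mul, map_mul, Complex.conj_I, Complex.conj_ofReal, Complex.conj_ofReal,
    Complex.conj_ofNat]
  push_cast; ring

theorem norm_expo_sub_one (t : ℝ) : ‖expo t - 1‖ = 2 * |Real.sin (Real.pi * t)| := by
  have h := Complex.norm_exp_I_mul_ofReal_sub_one (2 * Real.pi * t)
  rw [show expo t = Complex.exp (Complex.I * ((2 * Real.pi * t : ℝ) : ℂ)) by
    rw [expo]; congr 1; push_cast; ring, h, norm_mul, Real.norm_eq_abs, Real.norm_eq_abs,
    abs_two]
  congr 3; ring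

/-- The Dirichlet kernel. -/
noncomputable def dirichletKernel (N : ℕ) (t : ℝ) : ℂ :=
  ∑ n ∈ Finset.Icc (-(N : ℤ)) N, expo (n * t)

theorem dirichletKernel_eq (N : ℕ) (t : ℝ) :
    dirichletKernel N t = expo (-(N * t)) * ∑ k ∈ Finset.range (2 * N + 1), expo t ^ k := by
  rw [dirichletKernel, Finset.mul_sum]
  symm
  refine Finset.sum_bij (fun k _ => (k : ℤ) - N) ?_ ?_ ?_ ?_
  · intro k hk
    rw [Finset.mem_range] at hk
    rw [Finset.mem_Icc]; omega
  · intro k _ l _ h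
    simpa using h
  · intro n hn
    rw [Finset.mem_Icc] at hn
    refine ⟨(n + N).toNat, ?_, ?_⟩
    · rw [Finset.mem_range]; omega
    · omega
  · intro k _
    rw [← expo_nat_mul, ← expo_add]
    congr 1; push_cast; ring

theorem norm_dirichletKernel_zero (N : ℕ) : ‖dirichletKernel N 0‖ = 2 * N + 1 := by
  rw [dirichletKernel_eq]
  simp only [mul_zero, neg_zero, expo_zero, one_pow, Finset.sum_const, Finset.card_range,
    nsmul_eq_mul, mul_one, one_mul]
  rw [Complex.norm_natCast]; push_cast; ring

theorem norm_dirichletKernel_neg (N : ℕ) (t : ℝ) :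
    ‖dirichletKernel N (-t)‖ = ‖dirichletKernel N t‖ := by
  rw [← RCLike.norm_conj (dirichletKernel N t)]
  congr 1
  rw [dirichletKernel, dirichletKernel, map_sum]
  refine Finset.sum_congr rfl fun n _ => ?_
  rw [star_expo]; congr 1; ring

theorem norm_dirichletKernel_le (N : ℕ) {t : ℝ} (ht : Real.sin (Real.pi * t) ≠ 0) :
    ‖dirichletKernel N t‖ ≤ 1 / |Real.sin (Real.pi * t)| := by
  have hs : 0 < |Real.sin (Real.pi * t)| := abs_pos.2 ht
  have hne : expo t ≠ 1 := by
    intro h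
    have := norm_expo_sub_one t
    rw [h, sub_self, norm_zero] at this
    linarith
  rw [dirichletKernel_eq, norm_mul, norm_expo, one_mul, geom_sum_eq hne, norm_div,
    norm_expo_sub_one, div_le_div_iff₀ (by positivity) hs, one_mul]
  gcongr
  calc _ ≤ ‖expo t ^ (2 * N + 1)‖ + ‖(1 : ℂ)‖ := norm_sub_le _ _
    _ = 2 := by rw [norm_pow, norm_expo, one_pow, norm_one]; norm_num

/-- Jordan's inequality at `t` or at `1 - t`, whichever is at most `1 / 2`. Adding the two bounds
avoids a case distinction later. -/
theorem sin_pi_mul_lower {t : ℝ} (h0 : 0 < t) (h1 : t < 1) :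
    0 < Real.sin (Real.pi * t) ∧
      1 / Real.sin (Real.pi * t) ≤ 1 / (2 * t) + 1 / (2 * (1 - t)) := by
  have hpi := Real.pi_pos
  have key : ∀ s : ℝ, 0 < s → s ≤ 1 / 2 → 2 * s ≤ Real.sin (Real.pi * s) := by
    intro s hs hs2
    have := Real.mul_le_sin (x := Real.pi * s) (by positivity) (by nlinarith)
    calc 2 * s = 2 / Real.pi * (Real.pi * s) := by field_simp
      _ ≤ _ := this
  rcases le_total t (1 / 2) with h | h
  · have h2 := key t h0 h
    refine ⟨by linarith, ?_⟩
    have h3 : 1 / Real.sin (Real.pi * t) ≤ 1 / (2 * t) := by gcongr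
    have h4 : 0 ≤ 1 / (2 * (1 - t)) := one_div_nonneg.2 (by linarith)
    linarith
  · have h2 := key (1 - t) (by linarith) (by linarith)
    rw [show Real.pi * (1 - t) = Real.pi - Real.pi * t by ring, Real.sin_pi_sub] at h2
    have h5 : 0 < 2 * (1 - t) := by linarith
    refine ⟨by linarith, ?_⟩
    have h3 : 1 / Real.sin (Real.pi * t) ≤ 1 / (2 * (1 - t)) := by gcongr
    have h4 : 0 ≤ 1 / (2 * t) := by positivity
    linarith

/-- The kernel is governed by the distance from `t` to the nearest integer, which is `-1`, `0` or
`1` when `|t| < 1`. -/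
theorem norm_dirichletKernel_le_of_abs_lt (N : ℕ) {t : ℝ} (h0 : t ≠ 0) (h1 : |t| < 1) :
    ‖dirichletKernel N t‖ ≤ (1 / |t| + 1 / |t - 1| + 1 / |t + 1|) / 2 := by
  have pos : ∀ s : ℝ, 0 < s → s < 1 →
      ‖dirichletKernel N s‖ ≤ (1 / |s| + 1 / |s - 1| + 1 / |s + 1|) / 2 := by
    intro s hs hs1
    obtain ⟨h2, h3⟩ := sin_pi_mul_lower hs hs1
    refine (norm_dirichletKernel_le N h2.ne').trans ?_
    rw [abs_of_pos h2, abs_of_pos hs, abs_sub_comm, abs_of_pos (by linarith : 0 < 1 - s)]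
    refine h3.trans ?_
    have : 0 ≤ 1 / |s + 1| := by positivity
    have e1 : 1 / (2 * s) = 1 / s / 2 := by rw [div_div, mul_comm]
    have e2 : 1 / (2 * (1 - s)) = 1 / (1 - s) / 2 := by rw [div_div, mul_comm]
    rw [e1, e2]; linarith
  rw [abs_lt] at h1
  rcases lt_or_gt_of_ne h0 with h | h
  · have h2 := pos (-t) (by linarith) (by linarith)
    rw [norm_dirichletKernel_neg, abs_neg, show -t - 1 = -(t + 1) by ring, abs_neg,
      show -t + 1 = -(t - 1) by ring, abs_neg] at h2
    linarith
  · exact pos t h h1.2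

/-- The floors of the `v a` are distinct integers in `[1, R]`, so the sum is dominated by a harmonic
number. -/
theorem sum_inv_le_of_separated {α : Type*} (s : Finset α) (v : α → ℝ) (R : ℕ)
    (h1 : ∀ a ∈ s, 1 ≤ v a) (hR : ∀ a ∈ s, v a ≤ R)
    (hsep : ∀ a ∈ s, ∀ b ∈ s, a ≠ b → 1 ≤ |v a - v b|) :
    ∑ a ∈ s, 1 / v a ≤ 1 + Real.log R := by
  have hfl : ∀ a ∈ s, 1 ≤ ⌊v a⌋₊ := fun a ha => Nat.one_le_floor_iff _ |>.2 (h1 a ha)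
  have hinj : Set.InjOn (fun a => ⌊v a⌋₊) s := by
    intro a ha b hb h
    by_contra hne
    have h2 := hsep a ha b hb hne
    have ha1 := Nat.floor_le (show 0 ≤ v a by linarith [h1 a ha])
    have hb1 := Nat.floor_le (show 0 ≤ v b by linarith [h1 b hb])
    have ha2 := Nat.lt_floor_add_one (v a)
    have hb2 := Nat.lt_floor_add_one (v b)
    simp only at h
    rw [h] at ha1 ha2
    have : |v a - v b| < 1 := by rw [abs_lt]; constructor <;> linarith
    linarith
  calc ∑ a ∈ s, 1 / v a ≤ ∑ a ∈ s, ((⌊v a⌋₊ : ℝ))⁻¹ := by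
        refine Finset.sum_le_sum fun a ha => ?_
        rw [one_div]
        have := hfl a ha
        gcongr
        exact Nat.floor_le (by linarith [h1 a ha])
    _ = ∑ k ∈ s.image (fun a => ⌊v a⌋₊), ((k : ℝ))⁻¹ := by
        rw [Finset.sum_image hinj]
    _ ≤ ∑ k ∈ Finset.Icc 1 R, ((k : ℝ))⁻¹ := by
        apply Finset.sum_le_sum_of_subset_of_nonneg _ fun _ _ _ => by positivity
        intro k hk
        obtain ⟨a, ha, rfl⟩ := Finset.mem_image.1 hk
        rw [Finset.mem_Icc]
        exact ⟨hfl a ha, Nat.floor_le_of_le (hR a ha)⟩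
    _ = (harmonic R : ℝ) := by
        rw [harmonic_eq_sum_Icc]; push_cast; rfl
    _ ≤ 1 + Real.log R := harmonic_le_one_add_log R

theorem one_le_abs_mul_sq {M : ℕ} {q y : ℚ} (hq : q.den ≤ M) (hy : y.den ≤ M) (hne : q ≠ y) :
    (1 : ℝ) ≤ |(q : ℝ) - y| * (M : ℝ) ^ 2 := by
  have h1 : (q - y) * (q.den * y.den) = (q.num * y.den - y.num * q.den : ℤ) := by
    push_cast
    rw [← Rat.mul_den_eq_num q, ← Rat.mul_den_eq_num y]; ring
  have h2 : (q.num * y.den - y.num * q.den : ℤ) ≠ 0 := by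
    intro h
    rw [h, Int.cast_zero, mul_eq_zero, sub_eq_zero] at h1
    rcases h1 with h1 | h1
    · exact hne h1
    · have := q.den_pos; have := y.den_pos
      norm_cast at h1
      have : 0 < q.den * y.den := by positivity
      omega
  have h3 : (1 : ℚ) ≤ |q - y| * (q.den * y.den) := by
    have h4 : |(q - y) * ((q.den : ℚ) * y.den)| = |q - y| * (q.den * y.den) := by
      rw [abs_mul, abs_of_nonneg (by positivity : (0 : ℚ) ≤ q.den * y.den)]
    rw [← h4, h1]
    exact_mod_cast Int.one_le_abs h2
  have h5 : (1 : ℝ) ≤ |(q : ℝ) - y| * (q.den * y.den) := by exact_mod_cast h3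
  refine h5.trans ?_
  rw [sq]
  gcongr

/-- Distinct fractions with denominators at most `M` are at least `1 / M ^ 2` apart. On each side of
`y` the distances to `y`, scaled by `M ^ 2`, are therefore 1-separated; the two sides give the
factor 2. -/
theorem sum_inv_abs_sub_le (P : Finset ℚ) {M : ℕ} (y : ℚ) (hP : ∀ q ∈ P, q.den ≤ M)
    (hy : y.den ≤ M) (hyP : y ∉ P) (hd : ∀ q ∈ P, |(q : ℝ) - y| ≤ 2) :
    ∑ q ∈ P, 1 / |(q : ℝ) - y| ≤ 2 * (M : ℝ) ^ 2 * (1 + Real.log (2 * M ^ 2)) := by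
  have hM : 0 < M := y.den_pos.trans_le hy
  have hM0 : (0 : ℝ) < (M : ℝ) ^ 2 := by positivity
  have hone : ∀ q ∈ P, (1 : ℝ) ≤ |(q : ℝ) - y| * (M : ℝ) ^ 2 := fun q hq =>
    one_le_abs_mul_sq (hP q hq) hy fun h => hyP (h ▸ hq)
  have side : ∀ P' ⊆ P, (∀ q ∈ P', ∀ q' ∈ P', |(|(q : ℝ) - y| - |(q' : ℝ) - y|)| =
      |(q : ℝ) - q'|) → ∑ q ∈ P', 1 / |(q : ℝ) - y| ≤ (M : ℝ) ^ 2 * (1 + Real.log (2 * M ^ 2)) := by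
    intro P' hP' hs
    have h := sum_inv_le_of_separated P' (fun q => |(q : ℝ) - y| * (M : ℝ) ^ 2) (2 * M ^ 2)
      (fun q hq => hone q (hP' hq)) (fun q hq => by
        push_cast
        gcongr
        exact hd q (hP' hq)) (fun q hq q' hq' hne => by
        rw [← sub_mul, abs_mul, hs q hq q' hq', abs_of_pos hM0]
        exact one_le_abs_mul_sq (hP q (hP' hq)) (hP q' (hP' hq')) hne)
    push_cast at h
    calc _ = (M : ℝ) ^ 2 * ∑ q ∈ P', 1 / (|(q : ℝ) - y| * (M : ℝ) ^ 2) := by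
          rw [Finset.mul_sum]
          refine Finset.sum_congr rfl fun q _ => ?_
          field_simp
      _ ≤ _ := by gcongr
  rw [← Finset.sum_filter_add_sum_filter_not P (fun q => y ≤ q)]
  have h1 := side (P.filter (fun q => y ≤ q)) (Finset.filter_subset _ _) (by
    intro q hq q' hq'
    have e1 : (y : ℝ) ≤ q := by exact_mod_cast (Finset.mem_filter.1 hq).2
    have e2 : (y : ℝ) ≤ q' := by exact_mod_cast (Finset.mem_filter.1 hq').2
    rw [abs_of_nonneg (sub_nonneg.2 e1), abs_of_nonneg (sub_nonneg.2 e2)]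
    congr 1; ring)
  have h2 := side (P.filter (fun q => ¬ y ≤ q)) (Finset.filter_subset _ _) (by
    intro q hq q' hq'
    have e1 : (q : ℝ) ≤ y := by exact_mod_cast (not_le.1 (Finset.mem_filter.1 hq).2).le
    have e2 : (q' : ℝ) ≤ y := by exact_mod_cast (not_le.1 (Finset.mem_filter.1 hq').2).le
    rw [abs_of_nonpos (sub_nonpos.2 e1), abs_of_nonpos (sub_nonpos.2 e2), abs_sub_comm]
    congr 1; ring)
  linarith

theorem den_add_intCast (q : ℚ) (k : ℤ) : (q + k).den = q.den := Rat.add_intCast_den q k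

/-- The diagonal term gives `2 * N + 1`. The rest is half of three sums of inverse distances, to `q
- 1`, `q` and `q + 1`, whose denominators are all that of `q`. -/
theorem sum_norm_dirichletKernel_le (N : ℕ) (P : Finset ℚ) {M : ℕ} (hP : ∀ q ∈ P, q.den ≤ M)
    (h01 : ∀ q ∈ P, 0 < q ∧ q < 1) {q : ℚ} (hq : q ∈ P) :
    ∑ q' ∈ P, ‖dirichletKernel N ((q : ℝ) - q')‖ ≤
      2 * N + 1 + 3 * (M : ℝ) ^ 2 * (1 + Real.log (2 * M ^ 2)) := by
  rw [← Finset.add_sum_erase _ _ hq, sub_self, norm_dirichletKernel_zero]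
  have hcast : ∀ q ∈ P, (0 : ℝ) < q ∧ (q : ℝ) < 1 := fun q hq => by exact_mod_cast h01 q hq
  have hq01 := hcast q hq
  have hsub : ∀ q' ∈ P.erase q, q' ∈ P := fun q' h => Finset.mem_of_mem_erase h
  have bound : ∀ k : ℤ, -1 ≤ k → k ≤ 1 →
      ∑ q' ∈ P.erase q, 1 / |(q' : ℝ) - ((q + k : ℚ) : ℝ)| ≤
        2 * (M : ℝ) ^ 2 * (1 + Real.log (2 * M ^ 2)) := by
    intro k hk1 hk2
    have hk1' : (-1 : ℝ) ≤ k := by exact_mod_cast hk1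
    have hk2' : (k : ℝ) ≤ 1 := by exact_mod_cast hk2
    refine sum_inv_abs_sub_le _ _ (fun q' h => hP q' (hsub q' h))
      (by rw [den_add_intCast]; exact hP q hq) ?_ ?_
    · intro hmem
      have h1 := h01 _ (hsub _ hmem)
      have h2 := h01 q hq
      have h3 : (-1 : ℚ) < k := by linarith [h1.1, h2.2]
      have h4 : (k : ℚ) < 1 := by linarith [h1.2, h2.1]
      have h3' : -1 < k := by exact_mod_cast h3
      have h4' : k < 1 := by exact_mod_cast h4
      have hk : k = 0 := by omega
      subst hk
      simp at hmem
    · intro q' hq'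
      have h1 := hcast q' (hsub _ hq')
      push_cast
      rw [abs_le]; constructor <;> linarith [h1.1, h1.2, hq01.1, hq01.2]
  have b0 := bound 0 (by norm_num) (by norm_num)
  have b1 := bound (-1) (by norm_num) (by norm_num)
  have b2 := bound 1 (by norm_num) (by norm_num)
  push_cast at b0 b1 b2
  have key : ∀ q' ∈ P.erase q, ‖dirichletKernel N ((q : ℝ) - q')‖ ≤
      (1 / |(q' : ℝ) - (q + 0)| + 1 / |(q' : ℝ) - (q + -1)| + 1 / |(q' : ℝ) - (q + 1)|) / 2 := by
    intro q' hq'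
    have h1 := hcast q' (hsub _ hq')
    have hne : (q : ℝ) - q' ≠ 0 := by
      rw [sub_ne_zero]
      exact_mod_cast (Finset.ne_of_mem_erase hq').symm
    refine (norm_dirichletKernel_le_of_abs_lt N hne ?_).trans (le_of_eq ?_)
    · rw [abs_lt]; constructor <;> linarith [h1.1, h1.2, hq01.1, hq01.2]
    · rw [abs_sub_comm (q : ℝ) q', abs_sub_comm ((q : ℝ) - q') 1,
        show (1 : ℝ) - (q - q') = q' - (q + -1) by ring, ← abs_neg ((q : ℝ) - q' + 1),
        show -((q : ℝ) - q' + 1) = q' - (q + 1) by ring, add_zero]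
  have := Finset.sum_le_sum key
  rw [← Finset.sum_div, Finset.sum_add_distrib, Finset.sum_add_distrib] at this
  linarith

/-- The exponential sum over a finite set of integers. -/
noncomputable def expSum (A : Finset ℤ) (t : ℝ) : ℂ := ∑ a ∈ A, expo (a * t)

/-- The dual form of the large sieve: the square is expanded into Dirichlet kernels, and `2 * |c q|
* |c q'| ≤ |c q| ^ 2 + |c q'| ^ 2` reduces the form to row sums, as in Schur's test. -/
theorem sum_norm_sq_le (N : ℕ) (P : Finset ℚ) (c : ℚ → ℂ) {R : ℝ}
    (hR : ∀ q ∈ P, ∑ q' ∈ P, ‖dirichletKernel N ((q : ℝ) - q')‖ ≤ R) :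
    ∑ n ∈ Finset.Icc (-(N : ℤ)) N, ‖∑ q ∈ P, c q * expo (n * q)‖ ^ 2 ≤
      R * ∑ q ∈ P, ‖c q‖ ^ 2 := by
  have hexp : ((∑ n ∈ Finset.Icc (-(N : ℤ)) N, ‖∑ q ∈ P, c q * expo (n * q)‖ ^ 2 : ℝ) : ℂ) =
      ∑ q ∈ P, ∑ q' ∈ P, c q * (starRingEnd ℂ) (c q') * dirichletKernel N ((q : ℝ) - q') := by
    push_cast
    have h1 : ∀ n : ℤ, ((‖∑ q ∈ P, c q * expo (n * q)‖ : ℂ)) ^ 2 =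
        ∑ q ∈ P, ∑ q' ∈ P, c q * (starRingEnd ℂ) (c q') * expo (n * ((q : ℝ) - q')) := by
      intro n
      rw [← Complex.mul_conj', map_sum, Finset.sum_mul_sum]
      refine Finset.sum_congr rfl fun q _ => Finset.sum_congr rfl fun q' _ => ?_
      rw [map_mul, star_expo, show (n : ℝ) * ((q : ℝ) - q') = n * q + -(n * q') by ring, expo_add]
      ring
    simp only [h1]
    rw [Finset.sum_comm]
    refine Finset.sum_congr rfl fun q _ => ?_
    rw [Finset.sum_comm]
    refine Finset.sum_congr rfl fun q' _ => ?_
    rw [dirichletKernel, Finset.mul_sum]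
  have h0 : 0 ≤ ∑ n ∈ Finset.Icc (-(N : ℤ)) N, ‖∑ q ∈ P, c q * expo (n * q)‖ ^ 2 :=
    Finset.sum_nonneg fun _ _ => by positivity
  calc _ = ‖((∑ n ∈ Finset.Icc (-(N : ℤ)) N, ‖∑ q ∈ P, c q * expo (n * q)‖ ^ 2 : ℝ) : ℂ)‖ := by
        rw [Complex.norm_real, Real.norm_of_nonneg h0]
    _ ≤ ∑ q ∈ P, ∑ q' ∈ P, ‖c q‖ * ‖c q'‖ * ‖dirichletKernel N ((q : ℝ) - q')‖ := by
        rw [hexp]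
        refine (norm_sum_le _ _).trans (Finset.sum_le_sum fun q _ => ?_)
        refine (norm_sum_le _ _).trans (Finset.sum_le_sum fun q' _ => ?_)
        rw [norm_mul, norm_mul, RCLike.norm_conj]
    _ ≤ ∑ q ∈ P, ∑ q' ∈ P, (‖c q‖ ^ 2 / 2 * ‖dirichletKernel N ((q : ℝ) - q')‖ +
          ‖c q'‖ ^ 2 / 2 * ‖dirichletKernel N ((q' : ℝ) - q)‖) := by
        refine Finset.sum_le_sum fun q _ => Finset.sum_le_sum fun q' _ => ?_
        rw [← norm_dirichletKernel_neg N ((q' : ℝ) - q), neg_sub, ← add_mul]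
        gcongr
        nlinarith [sq_nonneg (‖c q‖ - ‖c q'‖)]
    _ = ∑ q ∈ P, ‖c q‖ ^ 2 * ∑ q' ∈ P, ‖dirichletKernel N ((q : ℝ) - q')‖ := by
        simp only [Finset.sum_add_distrib]
        rw [Finset.sum_comm (f := fun q q' : ℚ => ‖c q'‖ ^ 2 / 2 * ‖dirichletKernel N ((q' : ℝ) - q)‖),
          ← Finset.sum_add_distrib]
        refine Finset.sum_congr rfl fun q _ => ?_
        rw [← Finset.mul_sum]; ring
    _ ≤ ∑ q ∈ P, ‖c q‖ ^ 2 * R := by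
        refine Finset.sum_le_sum fun q hq => ?_
        gcongr
        exact hR q hq
    _ = _ := by rw [← Finset.sum_mul, mul_comm]

/-- The large sieve inequality, with a logarithmic loss. -/
theorem large_sieve (N : ℕ) (P : Finset ℚ) {M : ℕ} (hP : ∀ q ∈ P, q.den ≤ M)
    (h01 : ∀ q ∈ P, 0 < q ∧ q < 1) {A : Finset ℤ} (hA : A ⊆ Finset.Icc (-(N : ℤ)) N) :
    ∑ q ∈ P, ‖expSum A q‖ ^ 2 ≤
      (2 * N + 1 + 3 * (M : ℝ) ^ 2 * (1 + Real.log (2 * M ^ 2))) * A.card := by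
  set R := 2 * N + 1 + 3 * (M : ℝ) ^ 2 * (1 + Real.log (2 * M ^ 2)) with hR
  -- Duality: with these coefficients `V` is the sum of `w` over `A`, so Cauchy–Schwarz and the dual
  -- inequality give `V ^ 2 ≤ |A| * R * V`.
  set c : ℚ → ℂ := fun q => (starRingEnd ℂ) (expSum A q) with hc
  set V := ∑ q ∈ P, ‖expSum A q‖ ^ 2 with hV
  set w : ℤ → ℂ := fun n => ∑ q ∈ P, c q * expo (n * q) with hw
  have hV0 : 0 ≤ V := Finset.sum_nonneg fun _ _ => by positivity
  have hVw : (V : ℂ) = ∑ a ∈ A, w a := by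
    rw [hV, hw, Finset.sum_comm]
    push_cast
    refine Finset.sum_congr rfl fun q _ => ?_
    rw [← Finset.mul_sum, ← Complex.conj_mul']
    rfl
  have h1 : V ≤ ∑ a ∈ A, ‖w a‖ := by
    calc V = ‖(V : ℂ)‖ := by rw [Complex.norm_real, Real.norm_of_nonneg hV0]
      _ ≤ _ := by rw [hVw]; exact norm_sum_le _ _
  have h2 : (∑ a ∈ A, ‖w a‖) ^ 2 ≤ A.card * ∑ a ∈ A, ‖w a‖ ^ 2 := sq_sum_le_card_mul_sum_sq
  have h3 : ∑ a ∈ A, ‖w a‖ ^ 2 ≤ R * V := by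
    refine (Finset.sum_le_sum_of_subset_of_nonneg hA fun _ _ _ => by positivity).trans ?_
    refine (sum_norm_sq_le N P c fun q hq => sum_norm_dirichletKernel_le N P hP h01 hq).trans ?_
    simp only [hc, RCLike.norm_conj]
    exact le_rfl
  have h4 : V * V ≤ (R * A.card) * V := by
    calc V * V = V ^ 2 := (sq V).symm
      _ ≤ (∑ a ∈ A, ‖w a‖) ^ 2 := by gcongr
      _ ≤ A.card * (R * V) := h2.trans (by gcongr)
      _ = _ := by ring
  rcases hV0.eq_or_lt with h | h
  · rw [← h]
    have hM : 0 ≤ Real.log (2 * M ^ 2) := by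
      rw [show (2 * M ^ 2 : ℝ) = ((2 * M ^ 2 : ℕ) : ℝ) by push_cast; ring]
      exact Real.log_natCast_nonneg _
    positivity
  · exact le_of_mul_le_mul_right h4 h

/-! ### Equidistribution of sums modulo rough moduli. -/

theorem expo_eq_one_iff {t : ℝ} : expo t = 1 ↔ ∃ k : ℤ, t = k := by
  rw [expo, Complex.exp_eq_one_iff]
  have h : (2 * Real.pi * Complex.I : ℂ) ≠ 0 := Complex.two_pi_I_ne_zero
  refine exists_congr fun k => ?_
  rw [show (2 * Real.pi * t * Complex.I : ℂ) = t * (2 * Real.pi * Complex.I) by ring,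
    mul_left_inj' h]
  exact_mod_cast Iff.rfl

theorem sum_expo_range {d : ℕ} (hd : d ≠ 0) (n : ℤ) :
    ∑ h ∈ Finset.range d, expo (n * (h / d)) = if (d : ℤ) ∣ n then (d : ℂ) else 0 := by
  have hd' : (d : ℝ) ≠ 0 := by exact_mod_cast hd
  have h1 : ∀ h : ℕ, expo (n * (h / d)) = expo (n / d) ^ h := by
    intro h
    rw [← expo_nat_mul]; congr 1; ring
  simp only [h1]
  have h2 : expo (n / d) = 1 ↔ (d : ℤ) ∣ n := by
    rw [expo_eq_one_iff]
    refine exists_congr fun k => ?_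
    rw [div_eq_iff hd', mul_comm]
    exact_mod_cast Iff.rfl
  split_ifs with h
  · simp [h2.2 h]
  · have hne : expo (n / d) ≠ 1 := fun h3 => h (h2.1 h3)
    rw [geom_sum_eq hne, ← expo_nat_mul, mul_div_cancel₀ _ hd', expo_eq_one_iff.2 ⟨n, rfl⟩,
      sub_self, zero_div]

/-- Orthogonality of additive characters modulo `d`: the frequency `h = 0` is the main term, the
others are the error. -/
theorem abs_dvdCount_add_sub_le (A B : Finset ℤ) {d : ℕ} (hd : d ≠ 0) :
    |dvdCount (A ×ˢ B) (fun x => x.1 + x.2) d - (A.card * B.card : ℝ) / d| ≤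
      (1 / d) * ∑ h ∈ Finset.Ioo 0 d, ‖expSum A (h / d)‖ * ‖expSum B (h / d)‖ := by
  have hd' : (0 : ℝ) < d := by exact_mod_cast Nat.pos_of_ne_zero hd
  have h1 : ((d * dvdCount (A ×ˢ B) (fun x => x.1 + x.2) d : ℝ) : ℂ) =
      ∑ h ∈ Finset.range d, expSum A (h / d) * expSum B (h / d) := by
    have h2 : ∀ h : ℕ, expSum A (h / d) * expSum B (h / d) =
        ∑ x ∈ A ×ˢ B, expo ((x.1 + x.2 : ℤ) * (h / d)) := by
      intro h
      rw [expSum, expSum, Finset.sum_mul_sum, Finset.sum_product]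
      refine Finset.sum_congr rfl fun a _ => Finset.sum_congr rfl fun b _ => ?_
      rw [← expo_add]; congr 1; push_cast; ring
    simp only [h2]
    rw [Finset.sum_comm, dvdCount, Finset.mul_sum]
    push_cast
    refine Finset.sum_congr rfl fun x _ => ?_
    have := sum_expo_range hd (x.1 + x.2)
    push_cast at this
    rw [this]
    split_ifs <;> simp
  have hr : Finset.range d = insert 0 (Finset.Ioo 0 d) := by
    ext h; simp only [Finset.mem_range, Finset.mem_insert, Finset.mem_Ioo]; omega
  rw [hr, Finset.sum_insert (by simp)] at h1
  have h0 : ∀ A : Finset ℤ, expSum A ((0 : ℕ) / d) = A.card := by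
    intro A; simp [expSum, expo_zero]
  rw [h0, h0] at h1
  have h3 : ((d * (dvdCount (A ×ˢ B) (fun x => x.1 + x.2) d - (A.card * B.card : ℝ) / d) : ℝ) : ℂ)
      = ∑ h ∈ Finset.Ioo 0 d, expSum A (h / d) * expSum B (h / d) := by
    rw [mul_sub, mul_div_cancel₀ _ hd'.ne', Complex.ofReal_sub, h1]
    push_cast; ring
  have h4 := congrArg norm h3
  rw [Complex.norm_real, Real.norm_eq_abs, abs_mul, abs_of_pos hd'] at h4
  rw [one_div_mul_eq_div, le_div_iff₀ hd', mul_comm, h4]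
  refine (norm_sum_le _ _).trans (Finset.sum_le_sum fun h _ => ?_)
  rw [norm_mul]

/-- The fractions in `(0, 1)` whose denominator (not necessarily reduced) lies in `D`. -/
noncomputable def fractions (D : Finset ℕ) : Finset ℚ :=
  (D.sigma fun d => Finset.Ioo 0 d).image fun x => (x.2 : ℚ) / (x.1 : ℚ)

theorem mem_fractions {D : Finset ℕ} {q : ℚ} :
    q ∈ fractions D ↔ ∃ d ∈ D, ∃ h : ℕ, 0 < h ∧ h < d ∧ (h : ℚ) / d = q := by
  simp only [fractions, Finset.mem_image, Finset.mem_sigma, Finset.mem_Ioo, Sigma.exists]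
  constructor
  · rintro ⟨d, h, ⟨h1, h2, h3⟩, h4⟩; exact ⟨d, h1, h, h2, h3, h4⟩
  · rintro ⟨d, h1, h, h2, h3, h4⟩; exact ⟨d, h, ⟨h1, h2, h3⟩, h4⟩

theorem den_dvd_of_div_eq {h d : ℕ} {q : ℚ} (hq : (h : ℚ) / d = q) : q.den ∣ d := by
  have := Rat.den_dvd (h : ℤ) (d : ℤ)
  rw [Rat.divInt_eq_div] at this
  push_cast at this
  rw [hq] at this
  exact_mod_cast this

/-- A fraction `q` arises as `h / d` only for `d = k * q.den`, at most once for each `k ≤ M`. Its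
total weight is then a harmonic sum over `k` times `1 / q.den`. -/
theorem sum_fractions_le {D : Finset ℕ} {M : ℕ} (hD : ∀ d ∈ D, d ≤ M) {G : ℚ → ℝ}
    (hG : ∀ q, 0 ≤ G q) :
    ∑ d ∈ D, (1 / (d : ℝ)) * ∑ h ∈ Finset.Ioo 0 d, G ((h : ℚ) / d) ≤
      (1 + Real.log M) * ∑ q ∈ fractions D, G q / q.den := by
  have h1 : ∑ d ∈ D, (1 / (d : ℝ)) * ∑ h ∈ Finset.Ioo 0 d, G ((h : ℚ) / d) =
      ∑ x ∈ D.sigma (fun d => Finset.Ioo 0 d), (1 / (x.1 : ℝ)) * G ((x.2 : ℚ) / x.1) := by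
    rw [Finset.sum_sigma]
    exact Finset.sum_congr rfl fun d _ => Finset.mul_sum _ _ _
  rw [h1, ← Finset.sum_fiberwise_of_maps_to (t := fractions D)
    (g := fun x : (_ : ℕ) × ℕ => (x.2 : ℚ) / (x.1 : ℚ))
    (fun x hx => Finset.mem_image_of_mem _ hx), Finset.mul_sum]
  refine Finset.sum_le_sum fun q hq => ?_
  have hden : (0 : ℝ) < q.den := by exact_mod_cast q.den_pos
  set S := (D.sigma (fun d => Finset.Ioo 0 d)).filter
    (fun x : (_ : ℕ) × ℕ => (x.2 : ℚ) / (x.1 : ℚ) = q) with hS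
  have hmem : ∀ x ∈ S, x.1 ∈ D ∧ 0 < x.2 ∧ x.2 < x.1 ∧ (x.2 : ℚ) / x.1 = q := by
    intro x hx
    simp only [hS, Finset.mem_filter, Finset.mem_sigma, Finset.mem_Ioo] at hx
    exact ⟨hx.1.1, hx.1.2.1, hx.1.2.2, hx.2⟩
  have hdvd : ∀ x ∈ S, q.den * (x.1 / q.den) = x.1 := fun x hx =>
    Nat.mul_div_cancel' (den_dvd_of_div_eq (hmem x hx).2.2.2)
  have hinj : Set.InjOn (fun x : (_ : ℕ) × ℕ => x.1 / q.den) S := by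
    rintro ⟨d, h⟩ hx ⟨d', h'⟩ hx' he
    have e1 := hdvd _ hx
    have e2 := hdvd _ hx'
    simp only at he e1 e2
    have hdd : d = d' := by rw [← e1, ← e2, he]
    subst hdd
    have m1 := hmem _ hx
    have m2 := hmem _ hx'
    simp only at m1 m2
    have hd0 : (d : ℚ) ≠ 0 := by
      have : d ≠ 0 := by omega
      exact_mod_cast this
    have : (h : ℚ) = h' := by
      have := m1.2.2.2.trans m2.2.2.2.symm
      rwa [div_left_inj' hd0] at this
    have hh : h = h' := by exact_mod_cast this
    rw [hh]
  calc ∑ x ∈ S, (1 / (x.1 : ℝ)) * G ((x.2 : ℚ) / x.1)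
      = ∑ x ∈ S, ((x.1 / q.den : ℕ) : ℝ)⁻¹ * (G q / q.den) := by
        refine Finset.sum_congr rfl fun x hx => ?_
        rw [(hmem x hx).2.2.2]
        have h3 : (x.1 : ℝ) = q.den * (x.1 / q.den : ℕ) := by exact_mod_cast (hdvd x hx).symm
        rw [h3]
        field_simp
    _ = (∑ k ∈ S.image (fun x => x.1 / q.den), (k : ℝ)⁻¹) * (G q / q.den) := by
        rw [Finset.sum_image hinj, Finset.sum_mul]
    _ ≤ (∑ k ∈ Finset.Icc 1 M, (k : ℝ)⁻¹) * (G q / q.den) := by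
        have := hG q
        gcongr
        intro k hk
        obtain ⟨x, hx, rfl⟩ := Finset.mem_image.1 hk
        rw [Finset.mem_Icc]
        constructor
        · by_contra h0
          change ¬ 1 ≤ x.1 / q.den at h0
          have h2 := hdvd x hx
          rw [show x.1 / q.den = 0 from Nat.lt_one_iff.1 (not_le.1 h0), mul_zero] at h2
          have := hmem x hx
          omega
        · exact (Nat.div_le_self _ _).trans (hD _ (hmem x hx).1)
    _ ≤ (1 + Real.log M) * (G q / q.den) := by
        have h2 : ∑ k ∈ Finset.Icc 1 M, (k : ℝ)⁻¹ ≤ 1 + Real.log M := by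
          have h3 := harmonic_le_one_add_log M
          rw [harmonic_eq_sum_Icc] at h3
          push_cast at h3
          exact h3
        exact mul_le_mul_of_nonneg_right h2 (div_nonneg (hG q) hden.le)

/-- The telescoping identity behind the partial summation that inserts the weights `1 / q.den` into
the large sieve. -/
theorem inv_eq_add_sum_Icc {d M : ℕ} (hd : 1 ≤ d) (hdM : d ≤ M) :
    (1 : ℝ) / d = 1 / (M + 1) + ∑ m ∈ Finset.Icc d M, 1 / ((m : ℝ) * (m + 1)) := by
  induction M, hdM using Nat.le_induction with
  | base =>
    have : (0 : ℝ) < d := by exact_mod_cast hd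
    rw [Finset.Icc_self, Finset.sum_singleton]
    field_simp
  | succ M hM ih =>
    rw [Finset.sum_Icc_succ_top (by omega), ih]
    have : (0 : ℝ) < M + 1 := by positivity
    push_cast
    field_simp; ring

/-- The large sieve with denominators weighted by `1 / den`. -/
theorem weighted_large_sieve (N : ℕ) (P : Finset ℚ) {M Y : ℕ} (hP : ∀ q ∈ P, q.den ≤ M)
    (hY : 1 ≤ Y) (hYM : Y ≤ M) (hPY : ∀ q ∈ P, Y ≤ q.den)
    (h01 : ∀ q ∈ P, 0 < q ∧ q < 1) {A : Finset ℤ} (hA : A ⊆ Finset.Icc (-(N : ℤ)) N) :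
    ∑ q ∈ P, ‖expSum A q‖ ^ 2 / q.den ≤
      ((2 * N + 1) / Y + 6 * M * (1 + Real.log (2 * M ^ 2))) * A.card := by
  set l := 1 + Real.log (2 * (M : ℝ) ^ 2) with hl
  have hM1 : (1 : ℝ) ≤ M := by exact_mod_cast hY.trans hYM
  have hl0 : 0 ≤ l := by
    have : 0 ≤ Real.log (2 * (M : ℝ) ^ 2) := Real.log_nonneg (by nlinarith)
    linarith
  set V : ℕ → ℝ := fun m => ∑ q ∈ P.filter (fun q => q.den ≤ m), ‖expSum A q‖ ^ 2 with hV
  have hVle : ∀ m, 1 ≤ m → m ≤ M → V m ≤ (2 * N + 1 + 3 * (m : ℝ) ^ 2 * l) * A.card := by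
    intro m hm hmM
    refine (large_sieve N (P.filter (fun q => q.den ≤ m))
      (fun q hq => (Finset.mem_filter.1 hq).2)
      (fun q hq => h01 q (Finset.mem_filter.1 hq).1) hA).trans ?_
    have hm' : (0 : ℝ) < m := by exact_mod_cast hm
    gcongr
    rw [hl]
    gcongr
  -- The sum may start at `Y` since no denominator is smaller; this is what turns the factor `2 * N
  -- + 1` into `(2 * N + 1) / Y`.
  have hsplit : ∑ q ∈ P, ‖expSum A q‖ ^ 2 / q.den =
      V M * (1 / (M + 1)) + ∑ m ∈ Finset.Icc Y M, V m * (1 / ((m : ℝ) * (m + 1))) := by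
    have hVM : V M = ∑ q ∈ P, ‖expSum A q‖ ^ 2 := by
      simp only [hV]; rw [Finset.filter_true_of_mem hP]
    rw [hVM]
    simp only [hV, Finset.sum_filter, Finset.sum_mul]
    rw [Finset.sum_comm, ← Finset.sum_add_distrib]
    refine Finset.sum_congr rfl fun q hq => ?_
    rw [div_eq_mul_one_div, inv_eq_add_sum_Icc q.den_pos (hP q hq), mul_add, Finset.mul_sum]
    congr 1
    simp only [ite_mul, zero_mul]
    rw [← Finset.sum_filter]
    refine Finset.sum_congr ?_ fun _ _ => rfl
    ext m
    have := hPY q hq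
    simp only [Finset.mem_Icc, Finset.mem_filter]; omega
  rw [hsplit]
  have hpt : ∀ m ∈ Finset.Icc Y M, V m * (1 / ((m : ℝ) * (m + 1))) ≤
      ((2 * N + 1) * (1 / ((m : ℝ) * (m + 1))) + 3 * l) * A.card := by
    intro m hm
    rw [Finset.mem_Icc] at hm
    have hm' : (0 : ℝ) < m := by exact_mod_cast hY.trans hm.1
    calc _ ≤ ((2 * N + 1 + 3 * (m : ℝ) ^ 2 * l) * A.card) * (1 / ((m : ℝ) * (m + 1))) := by
          gcongr
          exact hVle m (hY.trans hm.1) hm.2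
      _ = ((2 * N + 1) * (1 / ((m : ℝ) * (m + 1))) + 3 * l * (m / (m + 1))) * A.card := by
          field_simp
      _ ≤ ((2 * N + 1) * (1 / ((m : ℝ) * (m + 1))) + 3 * l * 1) * A.card := by
          gcongr
          rw [div_le_one (by positivity)]; linarith
      _ = _ := by rw [mul_one]
  have hend : V M * (1 / (M + 1)) ≤ ((2 * N + 1) * (1 / (M + 1)) + 3 * M * l) * A.card := by
    calc _ ≤ ((2 * N + 1 + 3 * (M : ℝ) ^ 2 * l) * A.card) * (1 / (M + 1)) := by
          gcongr
          exact hVle M (hY.trans hYM) le_rfl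
      _ = ((2 * N + 1) * (1 / (M + 1)) + 3 * M * l * (M / (M + 1))) * A.card := by
          field_simp
      _ ≤ ((2 * N + 1) * (1 / (M + 1)) + 3 * M * l * 1) * A.card := by
          gcongr
          rw [div_le_one (by positivity)]; linarith
      _ = _ := by rw [mul_one]
  calc _ ≤ ((2 * N + 1) * (1 / (M + 1)) + 3 * M * l) * A.card +
        ∑ m ∈ Finset.Icc Y M, ((2 * N + 1) * (1 / ((m : ℝ) * (m + 1))) + 3 * l) * A.card :=
        add_le_add hend (Finset.sum_le_sum hpt)
    _ = ((2 * N + 1) * (1 / (M + 1) + ∑ m ∈ Finset.Icc Y M, 1 / ((m : ℝ) * (m + 1))) +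
          3 * M * l + (Finset.Icc Y M).card * (3 * l)) * A.card := by
        rw [← Finset.sum_mul, Finset.sum_add_distrib, ← Finset.mul_sum, Finset.sum_const,
          nsmul_eq_mul]
        ring
    _ ≤ ((2 * N + 1) * (1 / Y) + 3 * M * l + M * (3 * l)) * A.card := by
        rw [← inv_eq_add_sum_Icc hY hYM]
        have : ((Finset.Icc Y M).card : ℝ) ≤ M := by
          rw [Nat.card_Icc]
          exact_mod_cast (by omega : M + 1 - Y ≤ M)
        gcongr
    _ = _ := by ring

/-- The reduced denominator divides a rough number and is not 1, hence has a prime factor above `y`.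
Here roughness pays off: small denominators, where the exponential sums may be large, do not occur.
-/
theorem lt_den_of_mem_fractions {y Q : ℝ} {q : ℚ} (hq : q ∈ fractions (roughSet y Q)) :
    y < q.den ∧ (q.den : ℝ) ≤ Q ∧ 0 < q ∧ q < 1 := by
  obtain ⟨d, hd, h, h0, hhd, he⟩ := mem_fractions.1 hq
  rw [mem_roughSet] at hd
  have hdvd := den_dvd_of_div_eq he
  have hd0 : 0 < d := h0.trans hhd
  have hd0' : (0 : ℚ) < d := by exact_mod_cast hd0
  have hq0 : 0 < q := by rw [← he]; positivity
  have hq1 : q < 1 := by rw [← he, div_lt_one hd0']; exact_mod_cast hhd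
  have hne : q.den ≠ 1 := by
    intro h1
    rw [← (Rat.den_eq_one_iff q).1 h1] at hq0 hq1
    have e1 : 0 < q.num := by exact_mod_cast hq0
    have e2 : q.num < 1 := by exact_mod_cast hq1
    omega
  obtain ⟨p, hp, hpd⟩ := Nat.exists_prime_and_dvd hne
  refine ⟨?_, ?_, hq0, hq1⟩
  · refine (hd.2.2 p hp (hpd.trans hdvd)).trans_le ?_
    exact_mod_cast Nat.le_of_dvd q.den_pos hpd
  · refine le_trans ?_ hd.1
    exact_mod_cast Nat.le_of_dvd hd0 hdvd

/-- Sums `a + b` are equidistributed on average modulo rough moduli. -/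
theorem sum_abs_dvdCount_add_sub_le (N : ℕ) {A B : Finset ℤ} (hA : A ⊆ Finset.Icc (-(N : ℤ)) N)
    (hB : B ⊆ Finset.Icc (-(N : ℤ)) N) {y Q : ℝ} (hy : 1 ≤ y) (hyQ : y + 1 ≤ Q) :
    ∑ d ∈ roughSet y Q,
        |dvdCount (A ×ˢ B) (fun x => x.1 + x.2) d - (A.card * B.card : ℝ) / d| ≤
      (1 + Real.log Q) * (((2 * N + 1) / y + 6 * Q * (1 + Real.log (2 * Q ^ 2))) *
        Real.sqrt (A.card * B.card)) := by
  set D := roughSet y Q with hDdef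
  set M := ⌊Q⌋₊ with hM
  have hQ0 : 0 ≤ Q := by linarith
  have hD : ∀ d ∈ D, d ≤ M := fun d hd => Nat.le_floor (mem_roughSet.1 hd).1
  have hD0 : ∀ d ∈ D, d ≠ 0 := fun d hd => (mem_roughSet.1 hd).2.1.ne_zero
  set Y := ⌊y⌋₊ + 1 with hY
  have hYM : Y ≤ M := by
    rw [hM, hY]
    apply Nat.le_floor
    push_cast
    linarith [Nat.floor_le (show 0 ≤ y by linarith)]
  have hMQ : (M : ℝ) ≤ Q := Nat.floor_le hQ0
  have hM1 : (1 : ℝ) ≤ M := by exact_mod_cast (show 1 ≤ Y by omega).trans hYM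
  have hyY : y ≤ Y := by rw [hY]; push_cast; exact (Nat.lt_floor_add_one y).le
  set P := fractions D with hPdef
  have hP := fun q (hq : q ∈ P) => lt_den_of_mem_fractions hq
  have hPM : ∀ q ∈ P, q.den ≤ M := fun q hq => Nat.le_floor (hP q hq).2.1
  have hPY : ∀ q ∈ P, Y ≤ q.den := by
    intro q hq
    rw [hY, Nat.succ_le_iff, Nat.floor_lt (by linarith)]
    exact (hP q hq).1
  have hP01 : ∀ q ∈ P, 0 < q ∧ q < 1 := fun q hq => (hP q hq).2.2
  set R := (2 * N + 1) / y + 6 * Q * (1 + Real.log (2 * Q ^ 2)) with hR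
  have hlogM : 0 ≤ Real.log (2 * (M : ℝ) ^ 2) := Real.log_nonneg (by nlinarith)
  have hlogMQ : Real.log (2 * (M : ℝ) ^ 2) ≤ Real.log (2 * Q ^ 2) := by
    apply Real.log_le_log (by positivity)
    gcongr
  have hR' : (2 * N + 1) / (Y : ℝ) + 6 * M * (1 + Real.log (2 * (M : ℝ) ^ 2)) ≤ R := by
    rw [hR]; gcongr
  have hR0 : 0 ≤ R := le_trans (by positivity) hR'
  have hW : ∀ A : Finset ℤ, A ⊆ Finset.Icc (-(N : ℤ)) N →
      ∑ q ∈ P, ‖expSum A q‖ ^ 2 / q.den ≤ R * A.card := fun A hA =>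
    (weighted_large_sieve N P hPM (by omega) hYM hPY hP01 hA).trans (by gcongr)
  -- Cauchy–Schwarz, with half of the weight `1 / q.den` given to each set.
  have hCS : ∑ q ∈ P, ‖expSum A q‖ * ‖expSum B q‖ / q.den ≤
      R * Real.sqrt (A.card * B.card) := by
    have h1 := Finset.sum_mul_sq_le_sq_mul_sq P (fun q => ‖expSum A q‖ / Real.sqrt q.den)
      (fun q => ‖expSum B q‖ / Real.sqrt q.den)
    have h2 : ∀ q : ℚ, ‖expSum A q‖ / Real.sqrt q.den * (‖expSum B q‖ / Real.sqrt q.den) =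
        ‖expSum A q‖ * ‖expSum B q‖ / q.den := by
      intro q
      rw [div_mul_div_comm, Real.mul_self_sqrt (by positivity)]
    have h3 : ∀ (A : Finset ℤ) (q : ℚ), (‖expSum A q‖ / Real.sqrt q.den) ^ 2 =
        ‖expSum A q‖ ^ 2 / q.den := by
      intro A q
      rw [div_pow, Real.sq_sqrt (by positivity)]
    simp only [h2, h3] at h1
    have h4 : (∑ q ∈ P, ‖expSum A q‖ * ‖expSum B q‖ / q.den) ^ 2 ≤
        (R * Real.sqrt (A.card * B.card)) ^ 2 := by
      refine h1.trans ?_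
      rw [mul_pow, Real.sq_sqrt (by positivity)]
      calc _ ≤ (R * A.card) * (R * B.card) :=
            mul_le_mul (hW A hA) (hW B hB)
              (Finset.sum_nonneg fun _ _ => by positivity) (by positivity)
        _ = _ := by ring
    exact (abs_le_of_sq_le_sq' h4 (by positivity)).2
  calc _ ≤ ∑ d ∈ D, (1 / (d : ℝ)) * ∑ h ∈ Finset.Ioo 0 d,
        ‖expSum A (((h : ℚ) / d : ℚ) : ℝ)‖ * ‖expSum B (((h : ℚ) / d : ℚ) : ℝ)‖ := by
        refine Finset.sum_le_sum fun d hd => ?_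
        push_cast
        exact abs_dvdCount_add_sub_le A B (hD0 d hd)
    _ ≤ (1 + Real.log M) * ∑ q ∈ P, ‖expSum A q‖ * ‖expSum B q‖ / q.den :=
        sum_fractions_le hD (G := fun q => ‖expSum A q‖ * ‖expSum B q‖) fun q => by positivity
    _ ≤ (1 + Real.log Q) * (R * Real.sqrt (A.card * B.card)) := by
        have h1 : Real.log M ≤ Real.log Q := Real.log_le_log (by linarith) hMQ
        have h2 : 0 ≤ Real.log M := Real.log_nonneg hM1
        exact mul_le_mul (by linarith) hCS (Finset.sum_nonneg fun _ _ => by positivity)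
          (by linarith)

/-! ### Choice of parameters and identification of the main term. -/

/-- The main term of the inclusion–exclusion count of `x^θ`-smooth numbers. -/
noncomputable def sieveMainTerm (θ η x : ℝ) : ℝ :=
  ∑ d ∈ roughSet (x ^ θ) (x ^ (1 - η / 2)), (ArithmeticFunction.moebius d : ℝ) / d

/-- The main term is the same for every family, so one family with a known count determines it for
all others. -/
theorem smooth_count_of_equidistributed {θ γ : ℝ} (hθ0 : 0 < θ) (hθ1 : θ ≤ 1) (hγ : 0 < γ) :
    ∃ η ε : ℝ, 0 < η ∧ η < 1 / 4 ∧ 0 < ε ∧ ∀ᶠ x : ℝ in atTop,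
      ∀ {ι : Type} (I : Finset ι) (n : ι → ℤ) (T : ℝ), 0 ≤ T → (∀ i ∈ I, n i ≠ 0) →
        (∀ i ∈ I, |(n i : ℝ)| ≤ 2 * x) →
        ∑ d ∈ roughSet (x ^ η) (x ^ (1 - η / 2)), |dvdCount I n d - T / d| ≤ ε * T →
        |∑ i ∈ I, (if IsSmooth (x ^ θ) (n i) then (1 : ℝ) else 0) - T * sieveMainTerm θ η x| ≤
          γ * T := by
  -- `K ≥ 2 / θ` gives `(x ^ θ) ^ K ≥ x ^ 2 > 2 * x`. The size of `L₀` makes `C * T / L ≤ γ / 2 *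
  -- T`, `η` makes the Mertens sum tend to `L₀ + 1`, and `ε` makes `E + 6 * C * E ≤ 7 * C * ε * T =
  -- γ / 2 * T`.
  obtain ⟨K, hK⟩ := exists_nat_ge (2 / θ)
  set C : ℝ := 1 + 2 ^ K with hC
  have hC1 : 1 ≤ C := by rw [hC]; linarith [pow_pos (two_pos : (0 : ℝ) < 2) K]
  have hC0 : 0 < C := by linarith
  set L₀ : ℝ := 2 * C / γ + 1 with hL₀
  have hL₀1 : 1 ≤ L₀ := by rw [hL₀]; linarith [show 0 < 2 * C / γ by positivity]
  set η : ℝ := θ / 4 * Real.exp (-(L₀ + 1)) with hη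
  have hη0 : 0 < η := by positivity
  have hηθ : η < θ / 4 := by
    rw [hη]
    have : Real.exp (-(L₀ + 1)) < 1 := Real.exp_lt_one_iff.2 (by linarith)
    nlinarith
  set ε : ℝ := γ / (14 * C) with hε
  refine ⟨η, ε, hη0, by linarith, by positivity, ?_⟩
  have hlog : Real.log (θ / 4 / η) = L₀ + 1 := by
    rw [hη, div_mul_cancel_left₀ (by positivity), ← Real.exp_neg, neg_neg, Real.log_exp]
  have hL := tendsto_sum_primesIoc_inv hη0 hηθ.le
  rw [hlog] at hL
  have hevL := hL.eventually_const_le (u := L₀) (by linarith)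
  have hev2 : ∀ᶠ x : ℝ in atTop, 2 ≤ x ^ (η / 2) :=
    (tendsto_rpow_atTop (by positivity)).eventually_ge_atTop 2
  filter_upwards [hevL, hev2, eventually_gt_atTop 2] with x hxL hx2 hx ι I n T hT hn hnX hE
  have hx0 : 0 < x := by linarith
  have hx1 : 1 ≤ x := by linarith
  have hmono : ∀ {a b : ℝ}, a ≤ b → x ^ a ≤ x ^ b := fun h =>
    Real.rpow_le_rpow_of_exponent_le hx1 h
  set L := ∑ p ∈ primesIoc (x ^ η) (x ^ (θ / 4)), (1 : ℝ) / p with hLdef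
  have h := abs_smooth_sub_le (y := x ^ η) (z := x ^ (θ / 4)) (u := x ^ θ) (Q := x ^ (1 - η / 2))
    (X := 2 * x) (K := K) I n hn hnX hT (by positivity) (hmono hηθ.le)
    (Real.one_le_rpow hx1 (by positivity)) (hmono (by linarith)) ?_ ?_ ?_ hE hLdef
    (hL₀1.trans hxL)
  · refine h.trans ?_
    have hLpos : 0 < L := by linarith
    have h1 : C * (T / L) ≤ γ / 2 * T := by
      rw [← mul_div_assoc, div_le_iff₀ hLpos]
      have : C ≤ γ / 2 * L := by
        have h2 : 2 * C / γ ≤ L := by linarith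
        rw [div_le_iff₀ hγ] at h2
        linarith
      calc C * T ≤ (γ / 2 * L) * T := by gcongr
        _ = _ := by ring
    have h2 : ε * T + C * (6 * (ε * T)) ≤ γ / 2 * T := by
      have h3 : ε * T ≤ C * (ε * T) := le_mul_of_one_le_left (by positivity) hC1
      have h4 : C * (ε * T) = γ / 14 * T := by rw [hε]; field_simp
      linarith
    linarith
  · rw [← Real.rpow_natCast, ← Real.rpow_mul hx0.le]
    exact hmono (by push_cast; linarith)
  · rw [← Real.rpow_add hx0, show 1 - η / 2 + η = η / 2 + 1 by ring, Real.rpow_add hx0,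
      Real.rpow_one]
    gcongr
  · rw [← Real.rpow_natCast, ← Real.rpow_mul hx0.le]
    rw [div_le_iff₀ hθ0] at hK
    calc 2 * x < x ^ (2 : ℝ) := by
          rw [Real.rpow_two]; nlinarith
      _ ≤ _ := hmono (by linarith)

theorem card_roughSet_le {y Q : ℝ} (hQ : 0 ≤ Q) : ((roughSet y Q).card : ℝ) ≤ Q := by
  refine le_trans ?_ (Nat.floor_le hQ)
  have h : (roughSet y Q).card ≤ (Finset.Icc 1 ⌊Q⌋₊).card := by
    classical
    exact Finset.card_le_card (Finset.filter_subset _ _)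
  rw [Nat.card_Icc, Nat.add_sub_cancel] at h
  exact_mod_cast h

theorem abs_dvdCount_Icc_sub_le {x : ℝ} (hx : 0 ≤ x) {d : ℕ} (hd : d ≠ 0) :
    |dvdCount (Finset.Icc 1 ⌊x⌋₊) (fun n : ℕ => (n : ℤ)) d - x / d| ≤ 1 := by
  have h1 : dvdCount (Finset.Icc 1 ⌊x⌋₊) (fun n : ℕ => (n : ℤ)) d = (⌊x / d⌋₊ : ℝ) := by
    rw [dvdCount, Finset.sum_boole, Nat.floor_div_natCast, ← Nat.Ioc_filter_dvd_card_eq_div]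
    simp only [Int.natCast_dvd_natCast]
    rfl
  rw [h1]
  have h2 := Nat.floor_le (show 0 ≤ x / d by positivity)
  have h3 := Nat.lt_floor_add_one (x / d)
  rw [abs_le]; constructor <;> linarith

theorem eventually_one_add_log_le {s : ℝ} (hs : 0 < s) :
    ∀ᶠ x : ℝ in atTop, 1 + Real.log (2 * x ^ 2) ≤ x ^ s := by
  have h1 := (isLittleO_log_rpow_atTop hs).bound (show (0 : ℝ) < 1 / 4 by norm_num)
  have h2 : ∀ᶠ x : ℝ in atTop, 2 * (1 + Real.log 2) ≤ x ^ s :=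
    (tendsto_rpow_atTop hs).eventually_ge_atTop _
  filter_upwards [h1, h2, eventually_ge_atTop 1] with x hx1 hx2 hx
  rw [Real.norm_of_nonneg (Real.log_nonneg hx), Real.norm_of_nonneg (by positivity)] at hx1
  rw [Real.log_mul (by norm_num) (by positivity), Real.log_pow]
  push_cast
  linarith

theorem not_isSmooth_zero (y : ℝ) : ¬ IsSmooth y 0 := by
  intro h
  obtain ⟨p, hp1, hp⟩ := Nat.exists_infinite_primes (⌈y⌉₊ + 1)
  have h1 := h p hp (dvd_zero _)
  have h2 := Nat.le_ceil y
  have h3 : ((⌈y⌉₊ + 1 : ℕ) : ℝ) ≤ p := by exact_mod_cast hp1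
  push_cast at h3
  linarith

theorem card_filter_add_eq_zero_le (A B : Finset ℤ) :
    ((A ×ˢ B).filter (fun p => p.1 + p.2 = 0)).card ≤ A.card := by
  apply Finset.card_le_card_of_injOn Prod.fst
  · intro p hp
    exact (Finset.mem_product.1 (Finset.mem_filter.1 hp).1).1
  · rintro ⟨a, b⟩ hp ⟨a', b'⟩ hp' h
    have h1 := (Finset.mem_filter.1 hp).2
    have h2 := (Finset.mem_filter.1 hp').2
    simp only at h h1 h2
    rw [Prod.mk.injEq]
    omega

/-- The sieve needs nonzero values. At most one `b` cancels each `a`, so dropping these pairs costs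
at most `|A|` for any modulus. -/
theorem abs_dvdCount_ne_zero_sub_le (A B : Finset ℤ) (d : ℕ) (c : ℝ) :
    |dvdCount ((A ×ˢ B).filter (fun p => p.1 + p.2 ≠ 0)) (fun p => p.1 + p.2) d - c| ≤
      |dvdCount (A ×ˢ B) (fun p => p.1 + p.2) d - c| + A.card := by
  have h1 : dvdCount (A ×ˢ B) (fun p => p.1 + p.2) d =
      dvdCount ((A ×ˢ B).filter (fun p => p.1 + p.2 ≠ 0)) (fun p => p.1 + p.2) d +
        (((A ×ˢ B).filter (fun p => p.1 + p.2 = 0)).card : ℝ) := by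
    rw [dvdCount, dvdCount, ← Finset.sum_filter_not_add_sum_filter _ (fun p => p.1 + p.2 = 0)]
    congr 1
    rw [Finset.card_eq_sum_ones, Nat.cast_sum]
    refine Finset.sum_congr rfl fun p hp => ?_
    rw [(Finset.mem_filter.1 hp).2, if_pos (dvd_zero _), Nat.cast_one]
  have h2 : (((A ×ˢ B).filter (fun p => p.1 + p.2 = 0)).card : ℝ) ≤ A.card := by
    exact_mod_cast card_filter_add_eq_zero_le A B
  have h3 : (0 : ℝ) ≤ ((A ×ˢ B).filter (fun p => p.1 + p.2 = 0)).card := Nat.cast_nonneg _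
  rw [h1]
  generalize (((A ×ˢ B).filter (fun p => p.1 + p.2 = 0)).card : ℝ) = z at h2 h3 ⊢
  generalize dvdCount ((A ×ˢ B).filter (fun p => p.1 + p.2 ≠ 0)) (fun p => p.1 + p.2) d = w
  have h4 : |z| ≤ A.card := by rwa [abs_of_nonneg h3]
  calc |w - c| = |(w + z - c) - z| := by congr 1; ring
    _ ≤ |w + z - c| + |z| := abs_sub _ _
    _ ≤ _ := by gcongr

/-- The large sieve error takes nine tenths of the allowance in `hkey`, the discarded zero sums the
remaining tenth. In the application `g` bounds the logarithms, `ν` is the size threshold for the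
sets and `s = √(a * b)`. -/
theorem combine_errors_le {g Q a b s ν ε : ℝ} (hg : 1 ≤ g) (hQ : 0 ≤ Q) (ha : 0 ≤ a)
    (hs : 0 ≤ s) (hε : 0 ≤ ε) (hkey : Q * g ^ 2 * 10 ≤ ε * ν) (hνs : ν ≤ s) (hνb : ν ≤ b)
    (hab : s * s = a * b) : g * ((3 * Q + 6 * Q * g) * s) + Q * a ≤ ε * (a * b) := by
  have hQg : Q ≤ Q * g := le_mul_of_one_le_right hQ hg
  have hQg2 : Q * g ≤ Q * g ^ 2 := by rw [sq]; nlinarith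
  have h1 : Q * g ^ 2 * 10 * s ≤ ε * (a * b) := by
    calc _ ≤ ε * ν * s := by gcongr
      _ ≤ ε * s * s := by gcongr
      _ = _ := by rw [mul_assoc, hab]
  have h2 : Q * g ^ 2 * 10 * a ≤ ε * (a * b) := by
    calc _ ≤ ε * ν * a := by gcongr
      _ ≤ ε * b * a := by gcongr
      _ = _ := by ring
  have h3 : g * ((3 * Q + 6 * Q * g) * s) ≤ Q * g ^ 2 * 9 * s := by
    calc _ = (3 * (Q * g) + 6 * (Q * g ^ 2)) * s := by ring
      _ ≤ _ := by gcongr; linarith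
  have h4 : Q * a ≤ Q * g ^ 2 * a := by gcongr; linarith
  linarith

theorem sum_abs_dvdCount_ne_zero_le {x η ε : ℝ} {A B : Finset ℤ} (hε : 0 ≤ ε)
    (hη0 : 0 < η) (hη1 : η < 1 / 4) (hx : 1 ≤ x)
    (hlog : 1 + Real.log (2 * x ^ 2) ≤ x ^ (η / 16)) (hxη : 10 ≤ ε * x ^ (η / 8))
    (hQ : x ^ η + 1 ≤ x ^ (1 - η / 2))
    (hA : A ⊆ Finset.Icc (-(⌊x⌋₊ : ℤ)) ⌊x⌋₊) (hB : B ⊆ Finset.Icc (-(⌊x⌋₊ : ℤ)) ⌊x⌋₊)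
    (hAx : x ^ (1 - η / 4) < A.card) (hBx : x ^ (1 - η / 4) < B.card) :
    ∑ d ∈ roughSet (x ^ η) (x ^ (1 - η / 2)),
      |dvdCount ((A ×ˢ B).filter (fun p => p.1 + p.2 ≠ 0)) (fun p => p.1 + p.2) d -
        (A.card * B.card : ℝ) / d| ≤ ε * (A.card * B.card) := by
  have hx0 : 0 < x := by linarith
  set y := x ^ η with hy
  set Q := x ^ (1 - η / 2) with hQdef
  set g := x ^ (η / 16) with hg
  have hg1 : 1 ≤ g := Real.one_le_rpow hx (by positivity)
  have hy1 : 1 ≤ y := Real.one_le_rpow hx hη0.le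
  have hQ1 : 1 ≤ Q := Real.one_le_rpow hx (by linarith)
  have hQx : Q ≤ x := by
    calc Q ≤ x ^ (1 : ℝ) := Real.rpow_le_rpow_of_exponent_le hx (by linarith)
      _ = x := Real.rpow_one x
  set a : ℝ := (A.card : ℝ) with ha
  set b : ℝ := (B.card : ℝ) with hb
  set ν := x ^ (1 - η / 4) with hν
  have hν0 : 0 < ν := by positivity
  have hsqrt : ν ≤ Real.sqrt (a * b) := by
    apply Real.le_sqrt_of_sq_le
    rw [sq]
    exact mul_le_mul hAx.le hBx.le hν0.le (by linarith)
  have hlogQ : 1 + Real.log Q ≤ g := by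
    refine le_trans ?_ hlog
    have := Real.log_le_log (show 0 < Q by linarith) (show Q ≤ 2 * x ^ 2 by nlinarith)
    linarith
  have hlogQ2 : 1 + Real.log (2 * Q ^ 2) ≤ g := by
    refine le_trans ?_ hlog
    have : Real.log (2 * Q ^ 2) ≤ Real.log (2 * x ^ 2) := by
      apply Real.log_le_log (by positivity); gcongr
    linarith
  have hyQ : (2 * (⌊x⌋₊ : ℝ) + 1) / y ≤ 3 * Q := by
    have h1 := Nat.floor_le hx0.le
    rw [div_le_iff₀ (by linarith)]
    have h2 : x ≤ Q * y := by
      rw [hQdef, hy, ← Real.rpow_add hx0]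
      calc x = x ^ (1 : ℝ) := (Real.rpow_one x).symm
        _ ≤ _ := Real.rpow_le_rpow_of_exponent_le hx (by linarith)
    linarith
  have hkey : Q * g ^ 2 * 10 ≤ ε * ν := by
    -- The exponents add up: `(1 - η / 2) + 2 * (η / 16) + η / 8 = 1 - η / 4`. The spare factor `x ^
    -- (η / 8)` beats `10 / ε`.
    have h1 : Q * g ^ 2 * x ^ (η / 8) = ν := by
      rw [hQdef, hg, hν, ← Real.rpow_natCast, ← Real.rpow_mul hx0.le, ← Real.rpow_add hx0,
        ← Real.rpow_add hx0]
      congr 1; push_cast; ring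
    calc Q * g ^ 2 * 10 ≤ Q * g ^ 2 * (ε * x ^ (η / 8)) := by gcongr
      _ = ε * ν := by rw [← h1]; ring
  have hls := sum_abs_dvdCount_add_sub_le ⌊x⌋₊ hA hB hy1 hQ
  calc _ ≤ ∑ d ∈ roughSet y Q,
        (|dvdCount (A ×ˢ B) (fun p => p.1 + p.2) d - a * b / d| + a) :=
        Finset.sum_le_sum fun d _ => abs_dvdCount_ne_zero_sub_le A B d _
    _ ≤ g * ((3 * Q + 6 * Q * g) * Real.sqrt (a * b)) + Q * a := by
        rw [Finset.sum_add_distrib, Finset.sum_const, nsmul_eq_mul]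
        have h0 := Real.log_nonneg hQ1
        have h1 := Real.log_nonneg (show 1 ≤ 2 * Q ^ 2 by nlinarith)
        refine add_le_add (hls.trans ?_) ?_
        · gcongr
        · gcongr
          exact card_roughSet_le (by linarith)
    _ ≤ ε * (a * b) :=
        combine_errors_le hg1 (by linarith) (by positivity) (Real.sqrt_nonneg _) hε hkey hsqrt
          hBx.le (Real.mul_self_sqrt (by positivity))

/-- `limUnder` is a meaningful value only once convergence is known, which the Buchstab induction
supplies. -/
theorem tendsto_dickmanRho {θ : ℝ} (hθ : 0 < θ) :
    Tendsto (fun x : ℝ => (smoothCount x (x ^ (1 / (1 / θ))) : ℝ) / x) atTop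
      (𝓝 (dickmanRho (1 / θ))) := by
  apply tendsto_nhds_limUnder
  rw [one_div_one_div]
  exact exists_tendsto_smoothDensity hθ

theorem tendsto_smoothDensity {θ : ℝ} (hθ : 0 < θ) :
    Tendsto (smoothDensity θ) atTop (𝓝 (dickmanRho (1 / θ))) := by
  have := tendsto_dickmanRho hθ
  rwa [one_div_one_div] at this

/-- Smooth sums from two dense enough finite sets of integers. -/
theorem smooth_add_integers {θ γ : ℝ} (hθ0 : 0 < θ) (hθ1 : θ ≤ 1) (hγ : 0 < γ) :
    ∃ ν : ℝ, 0 < ν ∧ ν < 1 ∧ ∀ᶠ x : ℝ in atTop, ∀ A B : Finset ℤ,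
      A ⊆ Finset.Icc (-(⌊x⌋₊ : ℤ)) ⌊x⌋₊ → B ⊆ Finset.Icc (-(⌊x⌋₊ : ℤ)) ⌊x⌋₊ →
      x ^ ν < (A.card : ℝ) → x ^ ν < (B.card : ℝ) →
      |∑ p ∈ A ×ˢ B, (if IsSmooth (x ^ θ) (p.1 + p.2) then (1 : ℝ) else 0)
          - dickmanRho (1 / θ) * ((A.card : ℝ) * (B.card : ℝ))|
        < γ * ((A.card : ℝ) * (B.card : ℝ)) := by
  obtain ⟨η, ε, hη0, hη1, hε, hev⟩ :=
    smooth_count_of_equidistributed hθ0 hθ1 (show 0 < γ / 4 by positivity)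
  refine ⟨1 - η / 4, by linarith, by linarith, ?_⟩
  have ev1 : ∀ᶠ x : ℝ in atTop, 10 ≤ ε * x ^ (η / 8) :=
    ((tendsto_rpow_atTop (by positivity)).const_mul_atTop hε).eventually_ge_atTop _
  have ev2 : ∀ᶠ x : ℝ in atTop, 2 ≤ x ^ (1 - η / 2 - η) :=
    (tendsto_rpow_atTop (by linarith)).eventually_ge_atTop _
  have ev3 : ∀ᶠ x : ℝ in atTop, 1 ≤ ε * x ^ (η / 2) :=
    ((tendsto_rpow_atTop (by positivity)).const_mul_atTop hε).eventually_ge_atTop _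
  have ev4 := Metric.tendsto_nhds.1 (tendsto_smoothDensity hθ0) (γ / 4) (by positivity)
  filter_upwards [hev, ev1, ev2, ev3, ev4, eventually_one_add_log_le (show 0 < η / 16 by positivity),
    eventually_ge_atTop 1] with x hx h1 h2 h3 h4 h5 hx1 A B hA hB hAx hBx
  have hx0 : 0 < x := by linarith
  have hfloor := Nat.floor_le hx0.le
  set M := sieveMainTerm θ η x
  -- The same sieve applied to the integers `1, …, ⌊x⌋` with `T = x`. Each modulus has error at most
  -- 1, so the total is at most `x ^ (1 - η / 2) ≤ ε * x`. This ties the main term to Dickman's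
  -- function.
  have hden : |smoothDensity θ x - M| ≤ γ / 4 := by
    have h := hx (Finset.Icc 1 ⌊x⌋₊) (fun n : ℕ => (n : ℤ)) x hx0.le
      (fun n hn => by have := (Finset.mem_Icc.1 hn).1; omega)
      (fun n hn => by
        have h6 : (n : ℝ) ≤ ⌊x⌋₊ := by exact_mod_cast (Finset.mem_Icc.1 hn).2
        rw [Int.cast_natCast, abs_of_nonneg (by positivity)]
        linarith) (by
        calc _ ≤ ∑ d ∈ roughSet (x ^ η) (x ^ (1 - η / 2)), (1 : ℝ) :=
              Finset.sum_le_sum fun d hd =>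
                abs_dvdCount_Icc_sub_le hx0.le (mem_roughSet.1 hd).2.1.ne_zero
          _ ≤ x ^ (1 - η / 2) := by
              rw [Finset.sum_const, nsmul_eq_mul, mul_one]
              exact card_roughSet_le (by positivity)
          _ ≤ x ^ (1 - η / 2) * (ε * x ^ (η / 2)) := le_mul_of_one_le_right (by positivity) h3
          _ = ε * x := by
              rw [mul_left_comm, ← Real.rpow_add hx0, sub_add_cancel, Real.rpow_one])
    rw [Finset.sum_boole] at h
    have h6 : smoothDensity θ x - M = ((smoothCount x (x ^ θ) : ℝ) - x * M) / x := by
      rw [smoothDensity]; field_simp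
    rw [h6, abs_div, abs_of_pos hx0, div_le_iff₀ hx0]
    exact h
  have ha : 0 < (A.card : ℝ) := lt_trans (by positivity) hAx
  have hb : 0 < (B.card : ℝ) := lt_trans (by positivity) hBx
  have hmem : ∀ {A : Finset ℤ}, A ⊆ Finset.Icc (-(⌊x⌋₊ : ℤ)) ⌊x⌋₊ → ∀ a ∈ A, |(a : ℝ)| ≤ x := by
    intro A hA a ha
    obtain ⟨e1, e2⟩ := Finset.mem_Icc.1 (hA ha)
    have e1' : (-(⌊x⌋₊ : ℝ)) ≤ a := by exact_mod_cast e1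
    have e2' : (a : ℝ) ≤ ⌊x⌋₊ := by exact_mod_cast e2
    rw [abs_le]; constructor <;> linarith
  have hpairs := hx ((A ×ˢ B).filter (fun p => p.1 + p.2 ≠ 0)) (fun p => p.1 + p.2)
    (A.card * B.card) (by positivity) (fun p hp => (Finset.mem_filter.1 hp).2)
    (fun p hp => by
      obtain ⟨e1, e2⟩ := Finset.mem_product.1 (Finset.mem_filter.1 hp).1
      push_cast
      refine (abs_add_le _ _).trans ?_
      linarith [hmem hA _ e1, hmem hB _ e2])
    (sum_abs_dvdCount_ne_zero_le hε.le hη0 hη1 hx1 h5 h1 (by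
      have e1 : 1 ≤ x ^ η := Real.one_le_rpow hx1 hη0.le
      have e2 : x ^ (1 - η / 2) = x ^ η * x ^ (1 - η / 2 - η) := by
        rw [← Real.rpow_add hx0]; congr 1; ring
      rw [e2]; nlinarith) hA hB hAx hBx)
  -- Zero is not smooth, so discarding zero sums does not change the count.
  have hsum : ∑ p ∈ A ×ˢ B, (if IsSmooth (x ^ θ) (p.1 + p.2) then (1 : ℝ) else 0) =
      ∑ p ∈ (A ×ˢ B).filter (fun p => p.1 + p.2 ≠ 0),
        (if IsSmooth (x ^ θ) (p.1 + p.2) then (1 : ℝ) else 0) := by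
    symm
    apply Finset.sum_filter_of_ne
    intro p _ h h0
    rw [h0, if_neg (not_isSmooth_zero _)] at h
    exact h rfl
  rw [hsum]
  rw [Real.dist_eq] at h4
  have hT : 0 < (A.card : ℝ) * B.card := by positivity
  set T := (A.card : ℝ) * B.card
  set S := ∑ p ∈ (A ×ˢ B).filter (fun p => p.1 + p.2 ≠ 0),
        (if IsSmooth (x ^ θ) (p.1 + p.2) then (1 : ℝ) else 0)
  have hρ : |dickmanRho (1 / θ) - M| ≤ γ / 2 := by
    rw [abs_le] at hden ⊢
    rw [abs_lt] at h4
    constructor <;> linarith [hden.1, hden.2, h4.1, h4.2]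
  calc |S - dickmanRho (1 / θ) * T| = |(S - T * M) - (dickmanRho (1 / θ) - M) * T| := by
        congr 1; ring
    _ ≤ |S - T * M| + |(dickmanRho (1 / θ) - M) * T| := abs_sub _ _
    _ ≤ γ / 4 * T + γ / 2 * T := by
        rw [abs_mul, abs_of_pos hT]
        gcongr
    _ < γ * T := by nlinarith

/-! ### Transfer to sets of positive integers. -/

theorem image_natCast_subset {x : ℝ} {A : Finset ℕ} (hA : A ⊆ Finset.Icc 1 ⌊x⌋₊) :
    A.image (fun a : ℕ => (a : ℤ)) ⊆ Finset.Icc (-(⌊x⌋₊ : ℤ)) ⌊x⌋₊ := by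
  intro n hn
  obtain ⟨a, ha, rfl⟩ := Finset.mem_image.1 hn
  have := Finset.mem_Icc.1 (hA ha)
  rw [Finset.mem_Icc]; omega

theorem image_neg_natCast_subset {x : ℝ} {A : Finset ℕ} (hA : A ⊆ Finset.Icc 1 ⌊x⌋₊) :
    A.image (fun a : ℕ => -(a : ℤ)) ⊆ Finset.Icc (-(⌊x⌋₊ : ℤ)) ⌊x⌋₊ := by
  intro n hn
  obtain ⟨a, ha, rfl⟩ := Finset.mem_image.1 hn
  have := Finset.mem_Icc.1 (hA ha)
  rw [Finset.mem_Icc]; omega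

theorem mainTheorem1 (θ γ : ℝ) (hθ0 : 0 < θ) (hθ1 : θ ≤ 1) (hγ : 0 < γ) :
    -- the limit that defines Dickman's function at `1 / θ` exists
    Tendsto (fun x : ℝ => (smoothCount x (x ^ (1 / (1 / θ))) : ℝ) / x) atTop
      (𝓝 (dickmanRho (1 / θ))) ∧
    -- sums
    (∃ ν : ℝ, 0 < ν ∧ ν < 1 ∧ ∀ᶠ x : ℝ in atTop, ∀ A B : Finset ℕ,
      A ⊆ Finset.Icc 1 ⌊x⌋₊ → B ⊆ Finset.Icc 1 ⌊x⌋₊ →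
      x ^ ν < (A.card : ℝ) → x ^ ν < (B.card : ℝ) →
      |((((A ×ˢ B).filter
            (fun p : ℕ × ℕ => IsSmooth (x ^ θ) ((p.1 : ℤ) + (p.2 : ℤ)))).card : ℕ) : ℝ)
          - dickmanRho (1 / θ) * ((A.card : ℝ) * (B.card : ℝ))|
        < γ * ((A.card : ℝ) * (B.card : ℝ))) ∧
    -- differences
    (∃ ν : ℝ, 0 < ν ∧ ν < 1 ∧ ∀ᶠ x : ℝ in atTop, ∀ A B : Finset ℕ,
      A ⊆ Finset.Icc 1 ⌊x⌋₊ → B ⊆ Finset.Icc 1 ⌊x⌋₊ →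
      x ^ ν < (A.card : ℝ) → x ^ ν < (B.card : ℝ) →
      |((((A ×ˢ B).filter
            (fun p : ℕ × ℕ => IsSmooth (x ^ θ) ((p.1 : ℤ) - (p.2 : ℤ)))).card : ℕ) : ℝ)
          - dickmanRho (1 / θ) * ((A.card : ℝ) * (B.card : ℝ))|
        < γ * ((A.card : ℝ) * (B.card : ℝ))) := by
  have hinj : Function.Injective (fun a : ℕ => (a : ℤ)) := Nat.cast_injective
  have hinj' : Function.Injective (fun a : ℕ => -(a : ℤ)) := neg_injective.comp hinj
  obtain ⟨ν, hν0, hν1, hev⟩ := smooth_add_integers hθ0 hθ1 hγ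
  refine ⟨tendsto_dickmanRho hθ0, ⟨ν, hν0, hν1, ?_⟩, ⟨ν, hν0, hν1, ?_⟩⟩
  · filter_upwards [hev] with x hx A B hA hB hAx hBx
    have h := hx _ _ (image_natCast_subset hA) (image_natCast_subset hB)
    rw [Finset.card_image_of_injective _ hinj, Finset.card_image_of_injective _ hinj,
      Finset.sum_product, Finset.sum_image hinj.injOn] at h
    simp only [Finset.sum_image hinj.injOn] at h
    rw [← Finset.sum_boole, Finset.sum_product]
    exact h hAx hBx
  · filter_upwards [hev] with x hx A B hA hB hAx hBx
    -- `a - b` is a sum over `A` and `-B`, which also lies in the symmetric interval, so the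
    -- exponent found for sums serves again.
    have h := hx _ _ (image_natCast_subset hA) (image_neg_natCast_subset hB)
    rw [Finset.card_image_of_injective _ hinj, Finset.card_image_of_injective _ hinj',
      Finset.sum_product, Finset.sum_image hinj.injOn] at h
    simp only [Finset.sum_image hinj'.injOn, ← sub_eq_add_neg] at h
    rw [← Finset.sum_boole, Finset.sum_product]
    exact h hAx hBx
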